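/- Let $n\ge 0$. An $\mathbb N$-manifold of degree $n$ (an $n$-manifold) is a pair $(M,C)$ of a smooth manifold $M$ (Hausdorff, second countable, finite-dimensional, without boundary) and a sheaf $C$ of $\mathbb N$-graded commutative $\mathbb R$-algebras on $M$ such that, for some graded vector space $\mathbf V=\bigoplus_{i=1}^n V_i$ of finite dimension, every point of $M$ has an open neighbourhood $U$ with an isomorphism $C|_U\cong C^\infty_U\otimes \mathrm{Sym}\,\mathbf V$ of sheaves of graded algebras; here $\mathrm{Sym}$ is the graded symmetric algebra, the right-hand side denotes the sheafification of $U'\mapsto C^\infty(U')\otimes\mathrm{Sym}\,\mathbf V$, and a graded sheaf is the direct sum, as a sheaf, of its homogeneous parts. An isomorphism $(M,C)\to(N,D)$ of $n$-manifolds is a diffeomorphism $\psi:M\to N$ together with a degree-preserving isomorphism $D\to\psi_*C$ of sheaves of algebras. Then every $n$-manifold $(M,C)$ is isomorphic to a split one: there are a smooth graded vector bundle $\mathbf W=\bigoplus_{i=1}^n W_i\to M$ of finite rank, concentrated in degrees $1,\dots,n$, and an isomorphism of $n$-manifolds, covering the identity of $M$, between $(M,C)$ and $(M,\Gamma_{\mathrm{Sym}\,\mathbf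 W})$, where $\Gamma_{\mathrm{Sym}\,\mathbf W}=\bigoplus_{l\ge 0}\Gamma_{\mathrm S^l\mathbf W}$ (direct sum of sheaves) is the sheaf of smooth sections of the graded symmetric algebra bundle of $\mathbf W$, which is itself an $n$-manifold. (The bundle and the isomorphism are not claimed to be canonical.) -/

import Mathlib

open TopologicalSpace Opposite CategoryTheory
open scoped Manifold ContDiff TensorProduct DirectSum

universe u

noncomputable section

/-! ### The graded symmetric algebra of a graded vector space in degrees `1, …, n`

A graded vector space `V = ⊕_{i=1}^n V_i` is a family `V : Fin n → Type`; the index `i : Fin n`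
stands for the degree `i + 1`. -/

section GradedSymmetric

variable {n : ℕ} (V : Fin n → Type) [∀ i, AddCommGroup (V i)] [∀ i, Module ℝ (V i)]

/-- The relations `v ⊗ w = (-1)^{|v||w|} w ⊗ v` for homogeneous `v`, `w`. -/
inductive GSymRel : TensorAlgebra ℝ (⨁ i, V i) → TensorAlgebra ℝ (⨁ i, V i) → Prop
  | swap (i j : Fin n) (v : V i) (w : V j) :
      GSymRel
        (TensorAlgebra.ι ℝ (DirectSum.lof ℝ (Fin n) V i v) *
          TensorAlgebra.ι ℝ (DirectSum.lof ℝ (Fin n) V j w))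
        ((-1 : ℝ) ^ (((i : ℕ) + 1) * ((j : ℕ) + 1)) •
          (TensorAlgebra.ι ℝ (DirectSum.lof ℝ (Fin n) V j w) *
            TensorAlgebra.ι ℝ (DirectSum.lof ℝ (Fin n) V i v)))

/-- The graded symmetric algebra `Sym V` of the graded vector space `V`. -/
abbrev GSym : Type := RingQuot (GSymRel V)

namespace GSym

/-- The inclusion `V_i → Sym V` of the generators of degree `i + 1`. -/
def gen (i : Fin n) : V i →ₗ[ℝ] GSym V :=
  (RingQuot.mkAlgHom ℝ (GSymRel V)).toLinearMap ∘ₗ TensorAlgebra.ι ℝ ∘ₗ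
    DirectSum.lof ℝ (Fin n) V i

/-- The monomial `v_1 ⋯ v_k` of a list of homogeneous vectors. -/
def monomial (L : List (Σ i, V i)) : GSym V := (L.map fun p => gen V p.1 p.2).prod

/-- The total degree `|v_1| + ⋯ + |v_k|` of a list of homogeneous vectors. -/
def totalDegree (L : List (Σ i, V i)) : ℕ := (L.map fun p => (p.1 : ℕ) + 1).sum

/-- The subspace `S^l V` of elements of degree `l` in `Sym V`. -/
def homog (l : ℕ) : Submodule ℝ (GSym V) :=
  Submodule.span ℝ {a | ∃ L : List (Σ i, V i), totalDegree V L = l ∧ a = monomial V L}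

theorem gen_mul_gen (i j : Fin n) (v : V i) (w : V j) :
    gen V i v * gen V j w =
      (-1 : ℝ) ^ (((i : ℕ) + 1) * ((j : ℕ) + 1)) • (gen V j w * gen V i v) := by
  have h := RingQuot.mkAlgHom_rel ℝ (GSymRel.swap (V := V) i j v w)
  simpa [gen, map_mul, map_smul] using h

theorem gen_mem (i : Fin n) (v : V i) : gen V i v ∈ homog V ((i : ℕ) + 1) :=
  Submodule.subset_span ⟨[⟨i, v⟩], by simp [totalDegree], by simp [monomial]⟩

theorem monomial_append (L L' : List (Σ i, V i)) :
    monomial V (L ++ L') = monomial V L * monomial V L' := by simp [monomial]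

theorem totalDegree_append (L L' : List (Σ i, V i)) :
    totalDegree V (L ++ L') = totalDegree V L + totalDegree V L' := by simp [totalDegree]

instance gradedMonoid : SetLike.GradedMonoid (homog V) where
  one_mem := Submodule.subset_span ⟨[], by simp [totalDegree], by simp [monomial]⟩
  mul_mem := by
    intro i j a b ha hb
    have h := Submodule.mul_mem_mul ha hb
    rw [homog, homog, Submodule.span_mul_span] at h
    refine Submodule.span_mono ?_ h
    rintro _ ⟨_, ⟨L, hL, rfl⟩, _, ⟨L', hL', rfl⟩, rfl⟩
    exact ⟨L ++ L', by rw [totalDegree_append, hL, hL'], (monomial_append V L L').symm⟩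

theorem iSup_homog : ⨆ l, homog V l = ⊤ := by
  classical
  set T : Submodule ℝ (GSym V) := Submodule.span ℝ (Set.range (monomial V)) with hT
  have hle : T ≤ ⨆ l, homog V l := by
    refine Submodule.span_le.2 ?_
    rintro _ ⟨L, rfl⟩
    exact Submodule.mem_iSup_of_mem (totalDegree V L) (Submodule.subset_span ⟨L, rfl, rfl⟩)
  have hmul : ∀ a ∈ T, ∀ b ∈ T, a * b ∈ T := by
    intro a ha b hb
    have h := Submodule.mul_mem_mul ha hb
    rw [hT, Submodule.span_mul_span] at h
    refine Submodule.span_mono ?_ h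
    rintro _ ⟨_, ⟨L, rfl⟩, _, ⟨L', rfl⟩, rfl⟩
    exact ⟨L ++ L', monomial_append V L L'⟩
  have hone : (1 : GSym V) ∈ T := Submodule.subset_span ⟨[], by simp [monomial]⟩
  rw [eq_top_iff]
  rintro a -
  refine hle ?_
  obtain ⟨t, rfl⟩ := RingQuot.mkAlgHom_surjective ℝ (GSymRel V) a
  induction t using TensorAlgebra.induction with
  | algebraMap r =>
    rw [AlgHom.commutes, Algebra.algebraMap_eq_smul_one]
    exact T.smul_mem _ hone
  | ι x =>
    induction x using DirectSum.induction_on with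
    | zero => simp
    | of i v => exact Submodule.subset_span ⟨[⟨i, v⟩], by
        simp [monomial, gen, DirectSum.lof_eq_of]⟩
    | add x y hx hy => rw [map_add, map_add]; exact T.add_mem hx hy
  | mul x y hx hy => rw [map_mul]; exact hmul _ hx _ hy
  | add x y hx hy => rw [map_add]; exact T.add_mem hx hy

/-- The algebra map `Sym V → (Sym V)[X]` sending a generator `v` of degree `d` to `v X^d`. -/
def weight : GSym V →ₐ[ℝ] Polynomial (GSym V) :=
  RingQuot.liftAlgHom ℝ ⟨TensorAlgebra.lift ℝ (DirectSum.toModule ℝ (Fin n) _ fun i =>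
    ((Polynomial.monomial ((i : ℕ) + 1)).restrictScalars ℝ) ∘ₗ gen V i), by
      rintro _ _ ⟨i, j, v, w⟩
      simp only [map_mul, map_smul, TensorAlgebra.lift_ι_apply, DirectSum.toModule_lof,
        LinearMap.comp_apply, LinearMap.restrictScalars_apply, Polynomial.monomial_mul_monomial]
      rw [gen_mul_gen, add_comm ((i : ℕ) + 1), Polynomial.smul_monomial]⟩

theorem weight_gen (i : Fin n) (v : V i) :
    weight V (gen V i v) = Polynomial.monomial ((i : ℕ) + 1) (gen V i v) := by
  simp [weight, gen]

theorem weight_monomial (L : List (Σ i, V i)) :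
    weight V (monomial V L) = Polynomial.monomial (totalDegree V L) (monomial V L) := by
  induction L with
  | nil => simp [monomial, totalDegree]
  | cons p L ih =>
    have h1 : monomial V (p :: L) = gen V p.1 p.2 * monomial V L := by simp [monomial]
    have h2 : totalDegree V (p :: L) = ((p.1 : ℕ) + 1) + totalDegree V L := by simp [totalDegree]
    rw [h1, h2, map_mul, ih, weight_gen, Polynomial.monomial_mul_monomial]

theorem weight_homog {l : ℕ} {a : GSym V} (ha : a ∈ homog V l) :
    weight V a = Polynomial.monomial l a := by
  induction ha using Submodule.span_induction with
  | mem x hx => obtain ⟨L, rfl, rfl⟩ := hx; exact weight_monomial V L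
  | zero => simp
  | add x y _ _ hx hy => rw [map_add, hx, hy, map_add]
  | smul r x _ hx => rw [map_smul, hx, Polynomial.smul_monomial]

theorem homog_indep : iSupIndep (homog V) := by
  rw [iSupIndep_def]
  intro l
  rw [Submodule.disjoint_def]
  intro a ha hb
  have hc : (weight V a).coeff l = 0 := by
    have hle : (⨆ j, ⨆ (_ : j ≠ l), homog V j) ≤ LinearMap.ker
        (((Polynomial.lcoeff (GSym V) l).restrictScalars ℝ) ∘ₗ (weight V).toLinearMap) := by
      refine iSup₂_le fun j hj b hb => ?_
      simp [weight_homog V hb, Polynomial.coeff_monomial, hj]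
    simpa using hle hb
  simpa [weight_homog V ha] using hc

theorem monomial_comm (L L' : List (Σ i, V i)) :
    monomial V L * monomial V L' =
      (-1 : ℝ) ^ (totalDegree V L * totalDegree V L') • (monomial V L' * monomial V L) := by
  have key : ∀ (i : Fin n) (v : V i) (L' : List (Σ i, V i)),
      gen V i v * monomial V L' =
        (-1 : ℝ) ^ (((i : ℕ) + 1) * totalDegree V L') • (monomial V L' * gen V i v) := by
    intro i v L'
    induction L' with
    | nil => simp [monomial, totalDegree]
    | cons q L' ih =>
      have h1 : monomial V (q :: L') = gen V q.1 q.2 * monomial V L' := by simp [monomial]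
      have h2 : totalDegree V (q :: L') = ((q.1 : ℕ) + 1) + totalDegree V L' := by
        simp [totalDegree]
      rw [h1, h2, ← mul_assoc, gen_mul_gen, smul_mul_assoc, mul_assoc, ih, mul_smul_comm,
        smul_smul, ← pow_add, mul_assoc, ← mul_add]
  induction L with
  | nil => simp [monomial, totalDegree]
  | cons p L ih =>
    have h1 : monomial V (p :: L) = gen V p.1 p.2 * monomial V L := by simp [monomial]
    have h2 : totalDegree V (p :: L) = ((p.1 : ℕ) + 1) + totalDegree V L := by simp [totalDegree]
    rw [h1, h2, mul_assoc, ih, mul_smul_comm, ← mul_assoc, key, smul_mul_assoc, smul_smul,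
      ← pow_add, mul_assoc, ← add_mul, add_comm (totalDegree V L)]

theorem homog_comm {i j : ℕ} {a b : GSym V} (ha : a ∈ homog V i) (hb : b ∈ homog V j) :
    a * b = (-1 : ℝ) ^ (i * j) • (b * a) := by
  induction ha using Submodule.span_induction with
  | zero => simp
  | add x y _ _ hx hy => rw [add_mul, mul_add, hx, hy, smul_add]
  | smul r x _ hx => rw [smul_mul_assoc, hx, mul_smul_comm, smul_comm]
  | mem x hx =>
    obtain ⟨L, rfl, rfl⟩ := hx
    induction hb using Submodule.span_induction with
    | zero => simp
    | add x y _ _ hx hy => rw [add_mul, mul_add, hx, hy, smul_add]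
    | smul r x _ hx => rw [smul_mul_assoc, mul_smul_comm, hx, smul_comm]
    | mem y hy => obtain ⟨L', rfl, rfl⟩ := hy; exact monomial_comm V L L'

end GSym

end GradedSymmetric

/-! ### Sheaves of graded commutative algebras -/

/-- A sheaf of `ℕ`-graded commutative `ℝ`-algebras on `M`: a sheaf of algebras that is the direct
sum, in the category of sheaves, of subsheaves `C^l`, `l ∈ ℕ`, of homogeneous sections (so that
sections are locally finite sums of homogeneous ones), with `C^i · C^j ⊆ C^{i+j}` and
`s t = (-1)^{ij} t s` for `s ∈ C^i`, `t ∈ C^j`. -/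
structure GradedAlgSheaf (M : Type u) [TopologicalSpace M] where
  /-- The underlying sheaf of algebras. -/
  sheaf : TopCat.Sheaf (AlgCat.{u} ℝ) (TopCat.of M)
  /-- The homogeneous sections of degree `l` over `U`. -/
  deg : ∀ (U : Opens M) (l : ℕ), Submodule ℝ (sheaf.presheaf.obj (op U) : AlgCat.{u} ℝ)
  gradedMonoid : ∀ U, SetLike.GradedMonoid (deg U)
  graded_comm : ∀ (U : Opens M) (i j : ℕ) (s t : (sheaf.presheaf.obj (op U) : AlgCat.{u} ℝ)),
    s ∈ deg U i → t ∈ deg U j → s * t = (-1 : ℝ) ^ (i * j) • (t * s)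
  res_mem : ∀ (U V : Opens M) (h : V ≤ U) (l : ℕ)
    (s : (sheaf.presheaf.obj (op U) : AlgCat.{u} ℝ)), s ∈ deg U l →
      (sheaf.presheaf.map (homOfLE h).op).hom s ∈ deg V l
  local_mem : ∀ (U : Opens M) (l : ℕ) (s : (sheaf.presheaf.obj (op U) : AlgCat.{u} ℝ)),
    (∀ x ∈ U, ∃ (V : Opens M) (h : V ≤ U), x ∈ V ∧
      (sheaf.presheaf.map (homOfLE h).op).hom s ∈ deg V l) → s ∈ deg U l
  indep : ∀ U, iSupIndep (deg U)
  local_decomp : ∀ (U : Opens M) (s : (sheaf.presheaf.obj (op U) : AlgCat.{u} ℝ)),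
    ∀ x ∈ U, ∃ (V : Opens M) (h : V ≤ U), x ∈ V ∧
      (sheaf.presheaf.map (homOfLE h).op).hom s ∈ ⨆ l, deg V l

namespace GradedAlgSheaf

variable {M : Type u} [TopologicalSpace M]

/-- The algebra `C(U)` of sections over `U`. -/
abbrev sec (C : GradedAlgSheaf M) (U : Opens M) : AlgCat.{u} ℝ := C.sheaf.presheaf.obj (op U)

/-- The restriction `C(U) → C(V)` for `V ⊆ U`. -/
def res (C : GradedAlgSheaf M) {U V : Opens M} (h : V ≤ U) : C.sec U →ₐ[ℝ] C.sec V :=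
  (C.sheaf.presheaf.map (homOfLE h).op).hom

/-- An isomorphism `C|_U ≅ D|_U` of sheaves of graded algebras on the open set `U`. -/
structure IsoOn (C D : GradedAlgSheaf M) (U : Opens M) where
  /-- The isomorphism on sections over `V ⊆ U`. -/
  equiv : ∀ V : Opens M, V ≤ U → (C.sec V ≃ₐ[ℝ] D.sec V)
  naturality : ∀ (V V' : Opens M) (hV : V ≤ U) (h : V' ≤ V) (s : C.sec V),
    equiv V' (h.trans hV) (C.res h s) = D.res h (equiv V hV s)
  mem_deg_iff : ∀ (V : Opens M) (hV : V ≤ U) (l : ℕ) (s : C.sec V),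
    equiv V hV s ∈ D.deg V l ↔ s ∈ C.deg V l

end GradedAlgSheaf

/-! ### Sheaves of sections with values in a family of graded algebras -/

/-- A family `(A x)_{x ∈ M}` of graded commutative algebras together with a presheaf of algebras
`U ↦ S U` of sections of it, every section in `S U` being a finite sum of homogeneous ones. -/
structure SectionPresheaf (M : Type u) [TopologicalSpace M] where
  /-- The algebra at a point. -/
  A : M → Type
  [ring : ∀ x, Ring (A x)]
  [algebra : ∀ x, Algebra ℝ (A x)]
  /-- The elements of degree `l` at a point. -/
  G : ∀ x, ℕ → Submodule ℝ (A x)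
  gradedMonoid : ∀ x, SetLike.GradedMonoid (G x)
  indep : ∀ x, iSupIndep (G x)
  graded_comm : ∀ (x : M) (i j : ℕ) (a b : A x), a ∈ G x i → b ∈ G x j →
    a * b = (-1 : ℝ) ^ (i * j) • (b * a)
  /-- The sections over `U`. -/
  S : ∀ U : Opens M, Subalgebra ℝ (∀ x : U, A x)
  S_res : ∀ (U V : Opens M) (h : V ≤ U) (s : ∀ x : U, A x), s ∈ S U →
    (fun x : V => s ⟨x, h x.2⟩) ∈ S V
  S_decomp : ∀ (U : Opens M) (s : ∀ x : U, A x), s ∈ S U →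
    s ∈ ⨆ l : ℕ, (S U).toSubmodule ⊓ Submodule.pi Set.univ fun x : U => G x l

namespace SectionPresheaf

variable {M : Type u} [TopologicalSpace M] (P : SectionPresheaf M)

instance (x : M) : Ring (P.A x) := P.ring x
instance (x : M) : Algebra ℝ (P.A x) := P.algebra x

/-- Being a section in `S U`. -/
def prelocal : TopCat.PrelocalPredicate (X := TopCat.of M) P.A where
  pred {U} s := s ∈ P.S U
  res i s hs := P.S_res _ _ i.le s hs

/-- The sections over `U` of the sheafification: the families that lie locally in `S`. -/
def sections (U : Opens M) : Subalgebra ℝ (∀ x : U, P.A x) where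
  carrier := {s | P.prelocal.sheafify.pred (U := U) s}
  mul_mem' {a b} ha hb := P.prelocal.sheafify_inductionOn₂' P.prelocal P.prelocal
    (fun a b => a * b)
    (fun {U V a b} ha hb => (P.S (U ⊓ V)).mul_mem (P.S_res U (U ⊓ V) inf_le_left a ha)
      (P.S_res V (U ⊓ V) inf_le_right b hb)) ha hb
  add_mem' {a b} ha hb := P.prelocal.sheafify_inductionOn₂' P.prelocal P.prelocal
    (fun a b => a + b)
    (fun {U V a b} ha hb => (P.S (U ⊓ V)).add_mem (P.S_res U (U ⊓ V) inf_le_left a ha)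
      (P.S_res V (U ⊓ V) inf_le_right b hb)) ha hb
  algebraMap_mem' r := TopCat.PrelocalPredicate.sheafifyOf (P := P.prelocal) (U := U)
    ((P.S U).algebraMap_mem r)

theorem mem_sections {U : Opens M} {s : ∀ x : U, P.A x} :
    s ∈ P.sections U ↔ ∀ x : U, ∃ (V : Opens M) (_ : x.1 ∈ V) (h : V ≤ U),
      (fun y : V => s ⟨y, h y.2⟩) ∈ P.S V :=
  ⟨fun hs x => let ⟨V, hx, i, h⟩ := hs x; ⟨V, hx, i.le, h⟩,
    fun hs x => let ⟨V, hx, i, h⟩ := hs x; ⟨V, hx, homOfLE i, h⟩⟩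

/-- Restriction of sections. -/
def restrict {U V : Opens M} (h : V ≤ U) : P.sections U →ₐ[ℝ] P.sections V where
  toFun s := ⟨fun x => s.1 ⟨x, h x.2⟩, P.prelocal.sheafify.res (homOfLE h) s.1 s.2⟩
  map_one' := rfl
  map_mul' _ _ := rfl
  map_zero' := rfl
  map_add' _ _ := rfl
  commutes' _ := rfl

/-- The presheaf of algebras of sections of the sheafification. -/
def presheaf : TopCat.Presheaf (AlgCat.{u} ℝ) (TopCat.of M) where
  obj U := AlgCat.of ℝ (P.sections U.unop)
  map i := AlgCat.ofHom (P.restrict i.unop.le)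
  map_id _ := rfl
  map_comp _ _ := rfl

theorem presheaf_isSheaf : P.presheaf.IsSheaf := by
  rw [TopCat.Presheaf.IsSheaf,
    CategoryTheory.Presheaf.isSheaf_iff_isSheaf_forget _ _ (CategoryTheory.forget (AlgCat.{u} ℝ))]
  exact (TopCat.subsheafToTypes P.prelocal.sheafify).property

/-- The homogeneous sections of degree `l`: those with values of degree `l` at each point. -/
def degree (U : Opens M) (l : ℕ) : Submodule ℝ (P.sections U) :=
  (Submodule.pi Set.univ fun x : U => P.G x l).comap (P.sections U).val.toLinearMap

theorem mem_degree {U : Opens M} {l : ℕ} {s : P.sections U} :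
    s ∈ P.degree U l ↔ ∀ x : U, s.1 x ∈ P.G x l := by
  simp [degree, Submodule.mem_pi]

theorem degree_indep (U : Opens M) : iSupIndep (P.degree U) := by
  rw [iSupIndep_def]
  intro l
  rw [Submodule.disjoint_def]
  intro s hs hs'
  refine Subtype.ext (funext fun x => ?_)
  let e : P.sections U →ₗ[ℝ] P.A x :=
    LinearMap.proj (φ := fun x : U => P.A x) x ∘ₗ (P.sections U).val.toLinearMap
  have hle : (⨆ j, ⨆ (_ : j ≠ l), P.degree U j) ≤
      (⨆ j, ⨆ (_ : j ≠ l), P.G x j).comap e :=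
    iSup₂_le fun j hj t ht => (le_iSup₂_of_le j hj le_rfl : P.G x j ≤ _) (P.mem_degree.1 ht x)
  exact Submodule.disjoint_def.1 (iSupIndep_def.1 (P.indep x) l) _ (P.mem_degree.1 hs x) (hle hs')

/-- The sheaf of graded algebras associated with `S`. -/
def gradedSheaf : GradedAlgSheaf M where
  sheaf := ⟨P.presheaf, P.presheaf_isSheaf⟩
  deg := P.degree
  gradedMonoid U :=
    { one_mem := P.mem_degree.2 fun x => (P.gradedMonoid x).one_mem
      mul_mem := fun _ _ _ _ ha hb => P.mem_degree.2 fun x =>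
        (P.gradedMonoid x).mul_mem (P.mem_degree.1 ha x) (P.mem_degree.1 hb x) }
  graded_comm U i j s t hs ht := Subtype.ext <| funext fun x =>
    P.graded_comm x i j _ _ (P.mem_degree.1 hs x) (P.mem_degree.1 ht x)
  res_mem U V h l s hs := P.mem_degree.2 fun x => P.mem_degree.1 hs ⟨x, h x.2⟩
  local_mem U l s hs := P.mem_degree.2 fun x => by
    obtain ⟨V, h, hx, hV⟩ := hs x x.2
    exact P.mem_degree.1 hV ⟨x, hx⟩
  indep U := P.degree_indep U
  local_decomp U s x hx := by
    obtain ⟨V, hxV, h, hs⟩ := P.mem_sections.1 s.2 ⟨x, hx⟩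
    refine ⟨V, h, hxV, ?_⟩
    have hs' := P.S_decomp V _ hs
    have hle : (⨆ l : ℕ, (P.S V).toSubmodule ⊓ Submodule.pi Set.univ fun x : V => P.G x l) ≤
        (⨆ l, P.degree V l).map (P.sections V).val.toLinearMap := by
      refine iSup_le fun l t ht => ?_
      exact ⟨⟨t, TopCat.PrelocalPredicate.sheafifyOf (P := P.prelocal) (U := V) ht.1⟩,
        Submodule.mem_iSup_of_mem l (P.mem_degree.2 fun y => ht.2 y trivial), rfl⟩
    obtain ⟨t, ht, hts⟩ := hle hs'
    have : t = P.restrict h s := Subtype.ext hts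
    exact this ▸ ht

end SectionPresheaf

/-! ### Manifolds -/

section Manifolds

variable {m n : ℕ} {M : Type u} [TopologicalSpace M] [ChartedSpace (EuclideanSpace ℝ (Fin m)) M]

/-- Smooth functions on `U` as functions with values in the multiples of `1 ∈ A`. -/
def scalarHom (A : Type) [Ring A] [Algebra ℝ A] (U : Opens M) :
    C^∞⟮𝓡 m, U; 𝓘(ℝ, ℝ), ℝ⟯ →ₐ[ℝ] (U → A) where
  toFun f x := algebraMap ℝ A (f x)
  map_one' := by ext; simp
  map_mul' f g := by ext; simp
  map_zero' := by ext; simp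
  map_add' f g := by ext; simp
  commutes' r := by ext; rfl

theorem scalarHom_commute (A : Type) [Ring A] [Algebra ℝ A] (U : Opens M)
    (f : C^∞⟮𝓡 m, U; 𝓘(ℝ, ℝ), ℝ⟯) (a : A) :
    Commute (scalarHom A U f) (Pi.constAlgHom ℝ U A a) :=
  funext fun x => Algebra.commutes (f x) a

/-- The evaluation `C^∞(U) ⊗ A → A^U`, `f ⊗ a ↦ (x ↦ f(x) a)`. -/
def evalTensor (A : Type) [Ring A] [Algebra ℝ A] (U : Opens M) :
    C^∞⟮𝓡 m, U; 𝓘(ℝ, ℝ), ℝ⟯ ⊗[ℝ] A →ₐ[ℝ] (U → A) :=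
  Algebra.TensorProduct.lift (scalarHom A U) (Pi.constAlgHom ℝ U A)
    (scalarHom_commute A U)

theorem evalTensor_tmul (A : Type) [Ring A] [Algebra ℝ A] (U : Opens M)
    (f : C^∞⟮𝓡 m, U; 𝓘(ℝ, ℝ), ℝ⟯) (a : A) (x : U) :
    evalTensor A U (f ⊗ₜ a) x = f x • a := by
  have h : evalTensor A U (f ⊗ₜ a) = scalarHom A U f * Pi.constAlgHom ℝ U A a :=
    Algebra.TensorProduct.lift_tmul _ _ _ _ _
  rw [h, Algebra.smul_def]
  rfl

/-- `C^∞(U) ⊗ A` is an algebra of functions on `U`. -/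
theorem evalTensor_injective (A : Type) [Ring A] [Algebra ℝ A] (U : Opens M) :
    Function.Injective (evalTensor (m := m) A U) := by
  classical
  rw [injective_iff_map_eq_zero]
  intro t ht
  let b := Module.Basis.ofVectorSpace ℝ A
  let e := TensorProduct.equivFinsuppOfBasisRight
    (M := C^∞⟮𝓡 m, U; 𝓘(ℝ, ℝ), ℝ⟯) b
  have key : ∀ (t : C^∞⟮𝓡 m, U; 𝓘(ℝ, ℝ), ℝ⟯ ⊗[ℝ] A) (x : U) (i),
      b.repr (evalTensor A U t x) i = e t i x := by
    intro t x i
    induction t using TensorProduct.induction_on with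
    | zero => simp
    | tmul f a =>
      rw [evalTensor_tmul]
      simp [e, mul_comm]
    | add t t' h h' =>
      rw [map_add, map_add, Pi.add_apply, map_add, Finsupp.add_apply, Finsupp.add_apply, h, h']
      rfl
  refine e.injective ?_
  rw [map_zero]
  ext i x
  rw [← key, ht]
  simp

/-- The presheaf `U ↦ C^∞(U) ⊗ Sym V`, realized inside the functions `U → Sym V`, where
`V = ⊕ V_i` and `V_i = ℝ^{r_i}` has degree `i + 1`. -/
def modelPresheaf (m : ℕ) (M : Type u) [TopologicalSpace M]
    [ChartedSpace (EuclideanSpace ℝ (Fin m)) M] (r : Fin n → ℕ) : SectionPresheaf M where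
  A _ := GSym fun i => Fin (r i) → ℝ
  G _ := GSym.homog _
  gradedMonoid _ := GSym.gradedMonoid _
  indep _ := GSym.homog_indep _
  graded_comm _ _ _ _ _ ha hb := GSym.homog_comm _ ha hb
  S U := (evalTensor (m := m) (GSym fun i => Fin (r i) → ℝ) U).range
  S_res U V h s := by
    rintro ⟨t, rfl⟩
    induction t using TensorProduct.induction_on with
    | zero => exact ⟨0, by ext; simp⟩
    | tmul f a =>
      exact ⟨ContMDiffMap.restrictRingHom (𝓡 m) 𝓘(ℝ, ℝ) ℝ h f ⊗ₜ a, by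
        ext x; exact (evalTensor_tmul _ V _ a x).trans (evalTensor_tmul _ U f a ⟨x, h x.2⟩).symm⟩
    | add t t' ht ht' =>
      rw [map_add]
      exact Subalgebra.add_mem _ ht ht'
  S_decomp U s := by
    rintro ⟨t, rfl⟩
    induction t using TensorProduct.induction_on with
    | zero => simp
    | tmul f a =>
      have ha : a ∈ ⨆ l, GSym.homog (fun i => Fin (r i) → ℝ) l := by
        rw [GSym.iSup_homog]; trivial
      induction ha using Submodule.iSup_induction' with
      | mem l a ha =>
        refine Submodule.mem_iSup_of_mem l ⟨⟨_, rfl⟩, fun x _ => ?_⟩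
        have := evalTensor_tmul (m := m) (GSym fun i => Fin (r i) → ℝ) U f a x
        exact this ▸ Submodule.smul_mem _ _ ha
      | zero => simp
      | add a b _ _ ha hb =>
        rw [TensorProduct.tmul_add, map_add]
        exact Submodule.add_mem _ ha hb
    | add t t' ht ht' =>
      rw [map_add]
      exact Submodule.add_mem _ ht ht'

/-- The sheaf `C^∞_M ⊗ Sym V`, i.e. the sheafification of `U ↦ C^∞(U) ⊗ Sym V`. -/
def modelSheaf (m : ℕ) (M : Type u) [TopologicalSpace M]
    [ChartedSpace (EuclideanSpace ℝ (Fin m)) M] (r : Fin n → ℕ) : GradedAlgSheaf M :=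
  (modelPresheaf m M r).gradedSheaf

/-- `(M, C)` is an `ℕ`-manifold of degree `n` (of dimension `m | r_1 | ⋯ | r_n` for some `r`):
locally, `C` is isomorphic to `C^∞ ⊗ Sym V` as a sheaf of graded algebras. -/
def IsNManifold (m n : ℕ) {M : Type u} [TopologicalSpace M]
    [ChartedSpace (EuclideanSpace ℝ (Fin m)) M] (C : GradedAlgSheaf M) : Prop :=
  ∃ r : Fin n → ℕ, ∀ x : M, ∃ U : Opens M, x ∈ U ∧ Nonempty (C.IsoOn (modelSheaf m M r) U)

/-- An isomorphism of `ℕ`-manifolds `(M, C) → (N, D)`: a diffeomorphism `ψ : M → N` together with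
an isomorphism `ψ^♯ : D → ψ_* C` of sheaves of graded algebras on `N`. -/
structure NManifoldIso {m m' : ℕ} {M N : Type u}
    [TopologicalSpace M] [ChartedSpace (EuclideanSpace ℝ (Fin m)) M]
    [TopologicalSpace N] [ChartedSpace (EuclideanSpace ℝ (Fin m')) N]
    (C : GradedAlgSheaf M) (D : GradedAlgSheaf N) where
  /-- The diffeomorphism `ψ` of the bodies. -/
  body : M ≃ₘ⟮𝓡 m, 𝓡 m'⟯ N
  /-- The isomorphism `D(V) ≅ C(ψ⁻¹ V)`. -/
  sharp : ∀ V : Opens N, D.sec V ≃ₐ[ℝ] C.sec (Opens.comap ⟨body, body.continuous⟩ V)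
  naturality : ∀ (V V' : Opens N) (h : V' ≤ V) (s : D.sec V),
    sharp V' (D.res h s) =
      C.res (Opens.comap_mono ⟨body, body.continuous⟩ h) (sharp V s)
  mem_deg_iff : ∀ (V : Opens N) (l : ℕ) (s : D.sec V),
    sharp V s ∈ C.deg _ l ↔ s ∈ D.deg V l

/-- A smooth graded vector bundle `W = ⊕_{i=1}^n W_i → M` of finite rank, concentrated in degrees
`1, …, n`; `fiber i` is the summand of degree `i + 1`. -/
structure GradedVectorBundle (m n : ℕ) (M : Type u) [TopologicalSpace M]
    [ChartedSpace (EuclideanSpace ℝ (Fin m)) M] where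
  /-- The rank of the summand of degree `i + 1`. -/
  rank : Fin n → ℕ
  /-- The fibres. -/
  fiber : Fin n → M → Type
  [addCommGroup : ∀ i x, AddCommGroup (fiber i x)]
  [module : ∀ i x, Module ℝ (fiber i x)]
  [fiberTopology : ∀ i x, TopologicalSpace (fiber i x)]
  [totalTopology : ∀ i, TopologicalSpace (Bundle.TotalSpace (Fin (rank i) → ℝ) (fiber i))]
  [fiberBundle : ∀ i, FiberBundle (Fin (rank i) → ℝ) (fiber i)]
  [vectorBundle : ∀ i, VectorBundle ℝ (Fin (rank i) → ℝ) (fiber i)]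
  [smooth : ∀ i, ContMDiffVectorBundle ∞ (Fin (rank i) → ℝ) (fiber i) (𝓡 m)]

namespace GradedVectorBundle

attribute [instance] addCommGroup module fiberTopology totalTopology fiberBundle vectorBundle
  smooth

variable (W : GradedVectorBundle m n M)

/-- `w` is a smooth section of `W_i` over `U` (its values outside `U` are irrelevant). -/
def IsSmoothSection (i : Fin n) (U : Opens M) (w : ∀ x, W.fiber i x) : Prop :=
  ContMDiffOn (𝓡 m) ((𝓡 m).prod 𝓘(ℝ, Fin (W.rank i) → ℝ)) ∞
    (fun x => Bundle.TotalSpace.mk' (Fin (W.rank i) → ℝ) x (w x)) U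

/-- The algebra of finite sums of products of smooth functions on `U` and smooth sections of the
bundles `W_i` over `U`, as sections of `Sym W`. Since the `W_i` have local smooth frames, a section
of `Sym W` is smooth (its coefficients in the monomials of local frames are smooth, and locally
only finitely many are non-zero) exactly if it lies locally in this algebra. -/
def polynomialSections (U : Opens M) : Subalgebra ℝ (∀ x : U, GSym fun i => W.fiber i x) :=
  Algebra.adjoin ℝ
    ({s | ∃ f : C^∞⟮𝓡 m, U; 𝓘(ℝ, ℝ), ℝ⟯, s = fun x => algebraMap ℝ _ (f x)} ∪
      {s | ∃ (i : Fin n) (w : ∀ x, W.fiber i x), W.IsSmoothSection i U w ∧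
        s = fun x : U => GSym.gen (fun i => W.fiber i x) i (w x)})

/-- The sections of `Sym W` that are polynomial in smooth sections of `W`. -/
def symPresheaf : SectionPresheaf M where
  A x := GSym fun i => W.fiber i x
  G _ := GSym.homog _
  gradedMonoid _ := GSym.gradedMonoid _
  indep _ := GSym.homog_indep _
  graded_comm _ _ _ _ _ ha hb := GSym.homog_comm _ ha hb
  S U := W.polynomialSections U
  S_res U V h s hs := by
    let ρ : (∀ x : U, GSym fun i => W.fiber i x) →ₐ[ℝ] (∀ x : V, GSym fun i => W.fiber i x) :=
      { toFun := fun s x => s ⟨x, h x.2⟩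
        map_one' := rfl
        map_mul' := fun _ _ => rfl
        map_zero' := rfl
        map_add' := fun _ _ => rfl
        commutes' := fun _ => rfl }
    have hle : W.polynomialSections U ≤ (W.polynomialSections V).comap ρ := by
      refine Algebra.adjoin_le ?_
      rintro _ (⟨f, rfl⟩ | ⟨i, w, hw, rfl⟩)
      · exact Algebra.subset_adjoin
          (Or.inl ⟨ContMDiffMap.restrictRingHom (𝓡 m) 𝓘(ℝ, ℝ) ℝ h f, rfl⟩)
      · exact Algebra.subset_adjoin (Or.inr ⟨i, w, hw.mono h, rfl⟩)
    exact hle hs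
  S_decomp U s hs := by
    induction hs using Algebra.adjoin_induction with
    | mem s hs =>
      have hs' := Algebra.subset_adjoin (R := ℝ) hs
      rcases hs with ⟨f, rfl⟩ | ⟨i, w, hw, rfl⟩
      · refine Submodule.mem_iSup_of_mem 0 ⟨hs', fun x _ => ?_⟩
        simp only [Algebra.algebraMap_eq_smul_one]
        exact Submodule.smul_mem _ _ (GSym.gradedMonoid _).one_mem
      · exact Submodule.mem_iSup_of_mem ((i : ℕ) + 1) ⟨hs', fun x _ => GSym.gen_mem (fun i => W.fiber i x) i (w x)⟩
    | algebraMap r =>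
      refine Submodule.mem_iSup_of_mem 0 ⟨Subalgebra.algebraMap_mem _ r, fun x _ => ?_⟩
      simp only [Algebra.algebraMap_eq_smul_one]
      exact Submodule.smul_mem _ _ (GSym.gradedMonoid _).one_mem
    | add s t _ _ hs ht => exact Submodule.add_mem _ hs ht
    | mul s t hs₀ ht₀ hs ht =>
      clear hs₀ ht₀
      induction hs using Submodule.iSup_induction' with
      | zero => rw [zero_mul]; exact Submodule.zero_mem _
      | add s s' _ _ hs hs' => rw [add_mul]; exact Submodule.add_mem _ hs hs'
      | mem k s hs =>
        induction ht using Submodule.iSup_induction' with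
        | zero => rw [mul_zero]; exact Submodule.zero_mem _
        | add t t' _ _ ht ht' => rw [mul_add]; exact Submodule.add_mem _ ht ht'
        | mem l t ht =>
          exact Submodule.mem_iSup_of_mem (k + l) ⟨Subalgebra.mul_mem _ hs.1 ht.1,
            fun x hx => (GSym.gradedMonoid _).mul_mem (hs.2 x hx) (ht.2 x hx)⟩

/-- The sheaf of graded algebras `Γ_{Sym W} = ⊕_l Γ_{S^l W}` of smooth sections of `Sym W`. -/
def symSheaf : GradedAlgSheaf M := W.symPresheaf.gradedSheaf

end GradedVectorBundle

end Manifolds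

end

/-!
Every `ℕ`-manifold is split, because the only obstruction, the nonlinear part of the transition
automorphisms, can be averaged away with a partition of unity.

In a local trivialization a section of `C` is a smooth function with values in the fixed graded
algebra `Sym V`. An isomorphism of sheaves of algebras over the identity of `M` respects smooth
functions, since `g(y)` is the only real number `t` for which `g - t` is not invertible near `y`
(`GradedAlgSheaf.IsoOn.evAt_eq_of_scalar`). Hence two trivializations `a`, `b` differ at each point
`y` by a graded automorphism `θ_ab(y)` of `Sym V` that depends smoothly on `y`
(`GradedAlgSheaf.IsoOn.transition_evAt`), and everything can be done pointwise.

Modulo products of elements of positive degree, `θ_ab(y)` induces linear automorphisms `λ_ab(y)` of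
the `V_i`. They form a cocycle, which defines the graded vector bundle `W`
(`TrivializationAtlas.bundle`). The composites `θ_ba ∘ λ_ab`, restricted to the generators, are
maps `V_i → Sym V` over the intersection of the domains of `a` and `b`, with linear part the identity.
Their average `∑_b ρ_b θ_ba λ_ab` with respect to a partition of unity again has linear part the
identity, and now it is compatible with the changes of trivialization: these act on the source by
`λ` and on the target by `θ` (`TrivializationAtlas.trans_average`). Its extension to an endomorphism
of the algebra `Sym V` is the identity up to monomials with more factors. As a monomial has at
most as many factors as its degree, the extension is unipotent on each homogeneous part, and its
inverse is a finite geometric series, so smooth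
(`GSym.IsUnipotent.bijective`, `TrivializationAtlas.exists_average_eq`). The extensions therefore
give an isomorphism between the sections of `Sym W` and those of `C`
(`TrivializationAtlas.unsplitIso`).
-/

noncomputable section

/-! ### Homomorphisms out of the graded symmetric algebra -/

namespace GSym

variable {n : ℕ}

section Lift

variable {V : Fin n → Type} [∀ i, AddCommGroup (V i)] [∀ i, Module ℝ (V i)]
variable {B : Type*} [Ring B] [Algebra ℝ B]

/-- The universal property of `Sym V`: linear maps `V_i → B` whose values commute up to the signs
of the degrees extend to an algebra homomorphism. -/
def lift (f : ∀ i, V i →ₗ[ℝ] B)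
    (hf : ∀ i j v w, f i v * f j w =
      (-1 : ℝ) ^ (((i : ℕ) + 1) * ((j : ℕ) + 1)) • (f j w * f i v)) : GSym V →ₐ[ℝ] B :=
  RingQuot.liftAlgHom ℝ ⟨TensorAlgebra.lift ℝ (DirectSum.toModule ℝ (Fin n) _ f), by
    rintro _ _ ⟨i, j, v, w⟩
    simp only [map_mul, map_smul, TensorAlgebra.lift_ι_apply, DirectSum.toModule_lof]
    exact hf i j v w⟩

@[simp]
theorem lift_gen (f : ∀ i, V i →ₗ[ℝ] B) (hf) (i : Fin n) (v : V i) :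
    lift f hf (gen V i v) = f i v := by
  simp [lift, gen]

theorem algHom_ext {f g : GSym V →ₐ[ℝ] B} (h : ∀ i v, f (gen V i v) = g (gen V i v)) :
    f = g := by
  refine RingQuot.ringQuot_ext' ℝ f g (TensorAlgebra.hom_ext ?_)
  refine DirectSum.linearMap_ext ℝ fun i => LinearMap.ext fun v => ?_
  exact h i v

/-- An algebra homomorphism out of `Sym V` that is homogeneous on generators is homogeneous. -/
theorem map_homog_of_gen {B : Type*} [Ring B] [Algebra ℝ B] (G : ℕ → Submodule ℝ B)
    [SetLike.GradedMonoid G] (f : GSym V →ₐ[ℝ] B)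
    (h : ∀ (i : Fin n) (v : V i), f (gen V i v) ∈ G ((i : ℕ) + 1)) {l : ℕ} {z : GSym V}
    (hz : z ∈ homog V l) :
    f z ∈ G l := by
  have key : ∀ L : List (Σ i, V i), f (monomial V L) ∈ G (totalDegree V L) := by
    intro L
    induction L with
    | nil => simpa [monomial, totalDegree] using SetLike.GradedOne.one_mem (A := G)
    | cons p L ih =>
      have h1 : monomial V (p :: L) = gen V p.1 p.2 * monomial V L := by simp [monomial]
      have h2 : totalDegree V (p :: L) = ((p.1 : ℕ) + 1) + totalDegree V L := by
        simp [totalDegree]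
      rw [h1, h2, map_mul]
      exact SetLike.GradedMul.mul_mem (h _ _) ih
  induction hz using Submodule.span_induction with
  | mem x hx => obtain ⟨L, rfl, rfl⟩ := hx; exact key L
  | zero => simp
  | add x y _ _ hx hy => rw [map_add]; exact Submodule.add_mem _ hx hy
  | smul r x _ hx => rw [map_smul]; exact Submodule.smul_mem _ _ hx

/-- Elements of `Sym V` are sums of monomials: an induction principle. -/
theorem monomial_induction {p : GSym V → Prop} (hm : ∀ L, p (monomial V L))
    (hadd : ∀ a b, p a → p b → p (a + b)) (hsmul : ∀ (c : ℝ) a, p a → p (c • a)) (z : GSym V) :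
    p z := by
  have hz : z ∈ ⨆ l, homog V l := by rw [iSup_homog]; trivial
  have h0 : p 0 := by simpa using hsmul 0 _ (hm [])
  induction hz using Submodule.iSup_induction' with
  | mem l a ha =>
    induction ha using Submodule.span_induction with
    | mem x hx => obtain ⟨L, _, rfl⟩ := hx; exact hm L
    | zero => exact h0
    | add x y _ _ hx hy => exact hadd _ _ hx hy
    | smul r x _ hx => exact hsmul _ _ hx
  | zero => exact h0
  | add a b _ _ ha hb => exact hadd _ _ ha hb

theorem mem_homog_zero {z : GSym V} (hz : z ∈ homog V 0) : ∃ c : ℝ, z = algebraMap ℝ _ c := by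
  induction hz using Submodule.span_induction with
  | mem x hx =>
    obtain ⟨L, hL, rfl⟩ := hx
    cases L with
    | nil => exact ⟨1, by simp [monomial]⟩
    | cons p L => simp [totalDegree] at hL
  | zero => exact ⟨0, by simp⟩
  | add x y _ _ hx hy =>
    obtain ⟨a, rfl⟩ := hx
    obtain ⟨b, rfl⟩ := hy
    exact ⟨a + b, by simp⟩
  | smul r x _ hx =>
    obtain ⟨a, rfl⟩ := hx
    exact ⟨r * a, by rw [map_mul, Algebra.smul_def]⟩

end Lift

section Map

variable {V V' V'' : Fin n → Type} [∀ i, AddCommGroup (V i)] [∀ i, Module ℝ (V i)]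
  [∀ i, AddCommGroup (V' i)] [∀ i, Module ℝ (V' i)]
  [∀ i, AddCommGroup (V'' i)] [∀ i, Module ℝ (V'' i)]

/-- The functor `Sym` on morphisms. -/
def map (f : ∀ i, V i →ₗ[ℝ] V' i) : GSym V →ₐ[ℝ] GSym V' :=
  lift (fun i => gen V' i ∘ₗ f i) fun i j _ _ => gen_mul_gen V' i j _ _

@[simp]
theorem map_gen (f : ∀ i, V i →ₗ[ℝ] V' i) (i : Fin n) (v : V i) :
    map f (gen V i v) = gen V' i (f i v) := by simp [map]

theorem map_map_of_leftInverse (f : ∀ i, V i →ₗ[ℝ] V' i) (g : ∀ i, V' i →ₗ[ℝ] V i)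
    (h : ∀ i v, g i (f i v) = v) (z : GSym V) : map g (map f z) = z := by
  have : (map g).comp (map f) = AlgHom.id ℝ _ := algHom_ext fun i v => by simp [h]
  exact DFunLike.congr_fun this z

theorem map_mem_homog (f : ∀ i, V i →ₗ[ℝ] V' i) {l : ℕ} {z : GSym V} (hz : z ∈ homog V l) :
    map f z ∈ homog V' l :=
  map_homog_of_gen (homog V') (map f) (fun i v => by rw [map_gen]; exact gen_mem V' i _) hz

theorem coeff_weight_mem (z : GSym V) (l : ℕ) : (weight V z).coeff l ∈ homog V l := by
  induction z using monomial_induction with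
  | hm L =>
    rw [weight_monomial, Polynomial.coeff_monomial]
    split_ifs with h
    · exact Submodule.subset_span ⟨L, h, rfl⟩
    · exact Submodule.zero_mem _
  | hadd a b ha hb => rw [map_add, Polynomial.coeff_add]; exact Submodule.add_mem _ ha hb
  | hsmul c a ha => rw [map_smul, Polynomial.coeff_smul]; exact Submodule.smul_mem _ _ ha

/-- An injective homomorphism that preserves degrees also reflects them, since it commutes with
the projections to the homogeneous parts, which are the coefficients of `weight`. -/
theorem mem_homog_of_map_mem {f : GSym V →ₐ[ℝ] GSym V'} (hf : Function.Injective f)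
    (hdeg : ∀ l, ∀ z ∈ homog V l, f z ∈ homog V' l) {l : ℕ} {z : GSym V}
    (hz : f z ∈ homog V' l) : z ∈ homog V l := by
  have key : ∀ z, (weight V' (f z)).coeff l = f ((weight V z).coeff l) := by
    intro z
    induction z using monomial_induction with
    | hm L =>
      have hL := hdeg (totalDegree V L) (monomial V L) (Submodule.subset_span ⟨L, rfl, rfl⟩)
      rw [weight_monomial, weight_homog _ hL, Polynomial.coeff_monomial, Polynomial.coeff_monomial]
      split_ifs
      · rfl
      · simp
    | hadd a b ha hb => simp [ha, hb]
    | hsmul c a ha => simp [ha]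
  have h := key z
  rw [weight_homog _ hz, Polynomial.coeff_monomial, if_pos rfl] at h
  rw [hf h]
  exact coeff_weight_mem z l

end Map

/-! ### The linear part -/

section Linear

/-- The coordinate space of degree `i + 1`. -/
abbrev Coord (r : Fin n → ℕ) (i : Fin n) : Type := Fin (r i) → ℝ

variable (r : Fin n → ℕ)

/-- The quotient of `Sym V` by the square of its augmentation ideal, a square-zero extension
of `ℝ` by `⊕ V_i`. -/
def toSquareZero : GSym (Coord r) →ₐ[ℝ] TrivSqZeroExt ℝ (∀ i, Coord r i) :=
  lift (fun i => (TrivSqZeroExt.inrHom ℝ _).restrictScalars ℝ ∘ₗ LinearMap.single ℝ (Coord r) i)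
    fun i j v w => by simp

/-- The augmentation `Sym V → ℝ`. -/
def aug : GSym (Coord r) →ₐ[ℝ] ℝ := (TrivSqZeroExt.fstHom ℝ ℝ _).comp (toSquareZero r)

/-- The linear part `Sym V → V_i`, which vanishes on products of elements of positive degree. -/
def lin (i : Fin n) : GSym (Coord r) →ₗ[ℝ] Coord r i :=
  LinearMap.proj i ∘ₗ TrivSqZeroExt.sndHom ℝ _ ∘ₗ (toSquareZero r).toLinearMap

@[simp]
theorem aug_gen (i : Fin n) (v : Coord r i) : aug r (gen _ i v) = 0 := by
  simp [aug, toSquareZero]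

theorem lin_gen (i j : Fin n) (v : Coord r j) :
    lin r i (gen _ j v) = (Pi.single j v : ∀ i, Coord r i) i := by
  simp [lin, toSquareZero]

@[simp]
theorem lin_gen_same (i : Fin n) (v : Coord r i) : lin r i (gen _ i v) = v := by
  simp [lin_gen]

@[simp]
theorem lin_one (i : Fin n) : lin r i 1 = 0 := by
  simp [lin]

theorem lin_mul (i : Fin n) (a b : GSym (Coord r)) :
    lin r i (a * b) = aug r a • lin r i b + aug r b • lin r i a := by
  simp [lin, aug]

theorem aug_eq_zero {l : ℕ} (hl : l ≠ 0) {z : GSym (Coord r)} (hz : z ∈ homog _ l) :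
    aug r z = 0 := by
  induction hz using Submodule.span_induction with
  | mem x hx =>
    obtain ⟨L, rfl, rfl⟩ := hx
    cases L with
    | nil => simp [totalDegree] at hl
    | cons p L => simp [monomial]
  | zero => simp
  | add x y _ _ hx hy => simp [hx, hy]
  | smul r x _ hx => simp [hx]

theorem lin_monomial_cons_cons (i : Fin n) (p q : Σ i, Coord r i) (L : List (Σ i, Coord r i)) :
    lin r i (monomial _ (p :: q :: L)) = 0 := by
  simp [monomial, lin_mul]

theorem lin_eq_zero {l : ℕ} {i : Fin n} (hl : l ≠ (i : ℕ) + 1) {z : GSym (Coord r)}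
    (hz : z ∈ homog _ l) : lin r i z = 0 := by
  induction hz using Submodule.span_induction with
  | mem x hx =>
    obtain ⟨L, rfl, rfl⟩ := hx
    match L with
    | [] => simp [monomial]
    | [p] =>
      have hp : i ≠ p.1 := by
        rintro rfl
        simp [totalDegree] at hl
      simp [monomial, lin_gen, Pi.single_eq_of_ne hp]
    | p :: q :: L => exact lin_monomial_cons_cons r i p q L
  | zero => simp
  | add x y _ _ hx hy => simp [hx, hy]
  | smul r x _ hx => simp [hx]

variable {r}

/-- The linear map induced on `V_i` by an endomorphism of `Sym V`. -/
def linPart (θ : GSym (Coord r) →ₐ[ℝ] GSym (Coord r)) (i : Fin n) : Coord r i →ₗ[ℝ] Coord r i :=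
  lin r i ∘ₗ θ.toLinearMap ∘ₗ gen _ i

theorem linPart_apply (θ : GSym (Coord r) →ₐ[ℝ] GSym (Coord r)) (i : Fin n) (v : Coord r i) :
    linPart θ i v = lin r i (θ (gen _ i v)) := rfl

/-- Endomorphisms of `Sym V` that preserve the degree. -/
def IsGraded (θ : GSym (Coord r) →ₐ[ℝ] GSym (Coord r)) : Prop :=
  ∀ l, ∀ z ∈ homog (Coord r) l, θ z ∈ homog (Coord r) l

theorem IsGraded.of_gen {θ : GSym (Coord r) →ₐ[ℝ] GSym (Coord r)}
    (h : ∀ (i : Fin n) (v : Coord r i), θ (gen _ i v) ∈ homog (Coord r) ((i : ℕ) + 1)) :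
    IsGraded θ :=
  fun _ _ hz => map_homog_of_gen _ θ h hz

/-- A graded endomorphism preserves the square of the augmentation ideal, so that its linear part
describes what it induces on linear parts. -/
theorem IsGraded.lin_apply {θ : GSym (Coord r) →ₐ[ℝ] GSym (Coord r)} (hθ : IsGraded θ)
    (i : Fin n) (z : GSym (Coord r)) : lin r i (θ z) = linPart θ i (lin r i z) := by
  have haug : ∀ p : Σ i, Coord r i, aug r (θ (gen _ p.1 p.2)) = 0 := fun p =>
    aug_eq_zero r (Nat.succ_ne_zero _) (hθ _ _ (gen_mem _ p.1 p.2))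
  induction z using monomial_induction with
  | hm L =>
    match L with
    | [] => simp [monomial]
    | [p] =>
      obtain ⟨j, v⟩ := p
      by_cases hij : i = j
      · subst hij
        simp [monomial, linPart_apply]
      · have h0 : lin r i (θ (gen _ j v)) = 0 :=
          lin_eq_zero r (by simpa [Fin.ext_iff, eq_comm] using hij) (hθ _ _ (gen_mem _ j v))
        simp [monomial, lin_gen, Pi.single_eq_of_ne hij, h0]
    | p :: q :: L =>
      rw [lin_monomial_cons_cons]
      simp [monomial, lin_mul, haug]
  | hadd a b ha hb => simp [ha, hb]
  | hsmul c a ha => simp [ha]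

end Linear

/-! ### Unipotent endomorphisms -/

section Unipotent

variable {r : Fin n → ℕ}

variable (r) in
/-- The span of the monomials of degree `l` with at least `k` factors. -/
def wordFiltration (k l : ℕ) : Submodule ℝ (GSym (Coord r)) :=
  Submodule.span ℝ {a | ∃ L : List (Σ i, Coord r i),
    (totalDegree _ L = l ∧ k ≤ L.length) ∧ a = monomial _ L}

theorem monomial_mem_wordFiltration (L : List (Σ i, Coord r i)) {k : ℕ} (hk : k ≤ L.length) :
    monomial _ L ∈ wordFiltration r k (totalDegree _ L) :=
  Submodule.subset_span ⟨L, ⟨rfl, hk⟩, rfl⟩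

theorem wordFiltration_antitone {k k' : ℕ} (h : k ≤ k') (l : ℕ) :
    wordFiltration r k' l ≤ wordFiltration r k l :=
  Submodule.span_mono fun _ ⟨L, ⟨h1, h2⟩, h3⟩ => ⟨L, ⟨h1, h.trans h2⟩, h3⟩

theorem homog_le_wordFiltration_zero (l : ℕ) : homog (Coord r) l ≤ wordFiltration r 0 l :=
  Submodule.span_mono fun _ ⟨L, h1, h3⟩ => ⟨L, ⟨h1, Nat.zero_le _⟩, h3⟩

theorem mul_mem_wordFiltration {k l k' l' : ℕ} {a b : GSym (Coord r)}
    (ha : a ∈ wordFiltration r k l) (hb : b ∈ wordFiltration r k' l') :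
    a * b ∈ wordFiltration r (k + k') (l + l') := by
  have h := Submodule.mul_mem_mul ha hb
  rw [wordFiltration, wordFiltration, Submodule.span_mul_span] at h
  refine Submodule.span_mono ?_ h
  rintro _ ⟨_, ⟨L, ⟨hL, hk⟩, rfl⟩, _, ⟨L', ⟨hL', hk'⟩, rfl⟩, rfl⟩
  refine ⟨L ++ L', ⟨by rw [totalDegree_append, hL, hL'], ?_⟩, (monomial_append _ L L').symm⟩
  rw [List.length_append]
  exact add_le_add hk hk'

theorem length_le_totalDegree (L : List (Σ i, Coord r i)) : L.length ≤ totalDegree _ L := by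
  induction L with
  | nil => simp
  | cons p L ih =>
    have h2 : totalDegree _ (p :: L) = ((p.1 : ℕ) + 1) + totalDegree _ L := by simp [totalDegree]
    rw [h2, List.length_cons]
    omega

/-- Every generator has positive degree, so a monomial has at most as many factors as its
degree. -/
theorem wordFiltration_eq_bot {k l : ℕ} (h : l < k) : wordFiltration r k l = ⊥ := by
  rw [wordFiltration, Submodule.span_eq_bot]
  rintro _ ⟨L, ⟨rfl, hk⟩, -⟩
  exact absurd (length_le_totalDegree L) (by omega)

theorem sub_gen_lin_mem (i : Fin n) {z : GSym (Coord r)} (hz : z ∈ homog _ ((i : ℕ) + 1)) :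
    z - gen _ i (lin r i z) ∈ wordFiltration r 2 ((i : ℕ) + 1) := by
  induction hz using Submodule.span_induction with
  | mem x hx =>
    obtain ⟨L, hL, rfl⟩ := hx
    match L with
    | [] => simp [totalDegree] at hL
    | [p] =>
      obtain ⟨j, v⟩ := p
      have hij : j = i := by simpa [totalDegree, Fin.ext_iff] using hL
      subst hij
      simp [monomial]
    | p :: q :: L =>
      rw [lin_monomial_cons_cons, map_zero, sub_zero, ← hL]
      exact monomial_mem_wordFiltration _ (by simp)
  | zero => simp
  | add x y _ _ hx hy =>
    rw [map_add, map_add, add_sub_add_comm]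
    exact Submodule.add_mem _ hx hy
  | smul c x _ hx =>
    rw [map_smul, map_smul, ← smul_sub]
    exact Submodule.smul_mem _ _ hx

/-- Endomorphisms that are the identity modulo products, in each degree. -/
def IsUnipotent (T : GSym (Coord r) →ₐ[ℝ] GSym (Coord r)) : Prop :=
  ∀ (i : Fin n) (v : Coord r i),
    T (gen _ i v) - gen _ i v ∈ wordFiltration r 2 ((i : ℕ) + 1)

theorem IsUnipotent.of_linPart {T : GSym (Coord r) →ₐ[ℝ] GSym (Coord r)} (hT : IsGraded T)
    (h : ∀ i v, linPart T i v = v) : IsUnipotent T := fun i v => by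
  have := sub_gen_lin_mem i (hT _ _ (gen_mem _ i v))
  rwa [← linPart_apply, h] at this

/-- The deviation `1 - T` of an endomorphism from the identity. -/
def defect (T : GSym (Coord r) →ₐ[ℝ] GSym (Coord r)) : Module.End ℝ (GSym (Coord r)) :=
  1 - T.toLinearMap

theorem defect_apply (T : GSym (Coord r) →ₐ[ℝ] GSym (Coord r)) (z : GSym (Coord r)) :
    defect T z = z - T z := rfl

namespace IsUnipotent

variable {T : GSym (Coord r) →ₐ[ℝ] GSym (Coord r)}

theorem monomial_sub_mem (hT : IsUnipotent T) (L : List (Σ i, Coord r i)) :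
    T (monomial _ L) - monomial _ L ∈ wordFiltration r (L.length + 1) (totalDegree _ L) := by
  induction L with
  | nil => simp [monomial]
  | cons p L ih =>
    have h1 : monomial _ (p :: L) = gen _ p.1 p.2 * monomial _ L := by simp [monomial]
    have h2 : totalDegree _ (p :: L) = ((p.1 : ℕ) + 1) + totalDegree _ L := by simp [totalDegree]
    have hL : T (monomial _ L) ∈ wordFiltration r L.length (totalDegree _ L) := by
      have := Submodule.add_mem _ (wordFiltration_antitone (Nat.le_succ _) _ ih)
        (monomial_mem_wordFiltration L le_rfl)
      simpa using this
    have hp : gen _ p.1 p.2 ∈ wordFiltration r 1 ((p.1 : ℕ) + 1) :=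
      Submodule.subset_span ⟨[p], by simp [totalDegree], by simp [monomial]⟩
    have h3 : T (monomial _ (p :: L)) - monomial _ (p :: L) =
        (T (gen _ p.1 p.2) - gen _ p.1 p.2) * T (monomial _ L) +
          gen _ p.1 p.2 * (T (monomial _ L) - monomial _ L) := by
      rw [h1, map_mul]
      rw [sub_mul, mul_sub]
      abel
    rw [h3, h2, List.length_cons]
    refine Submodule.add_mem _ ?_ ?_
    · have h4 : L.length + 1 + 1 = 2 + L.length := by omega
      rw [h4]
      exact mul_mem_wordFiltration (hT p.1 p.2) hL
    · have h4 : L.length + 1 + 1 = 1 + (L.length + 1) := by omega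
      rw [h4]
      exact mul_mem_wordFiltration hp ih

theorem defect_mem (hT : IsUnipotent T) {k l : ℕ} {z : GSym (Coord r)}
    (hz : z ∈ wordFiltration r k l) : defect T z ∈ wordFiltration r (k + 1) l := by
  induction hz using Submodule.span_induction with
  | mem x hx =>
    obtain ⟨L, ⟨rfl, hk⟩, rfl⟩ := hx
    rw [defect_apply, ← neg_sub]
    exact Submodule.neg_mem _
      (wordFiltration_antitone (Nat.succ_le_succ hk) _ (hT.monomial_sub_mem L))
  | zero => simp
  | add x y _ _ hx hy => rw [map_add]; exact Submodule.add_mem _ hx hy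
  | smul c x _ hx => rw [map_smul]; exact Submodule.smul_mem _ _ hx

end IsUnipotent

/-- The defect of a unipotent endomorphism is locally nilpotent, with an exponent that does not
depend on the endomorphism. -/
theorem exists_defect_pow_eq_zero (z : GSym (Coord r)) :
    ∃ k : ℕ, ∀ T : GSym (Coord r) →ₐ[ℝ] GSym (Coord r), IsUnipotent T → (defect T ^ k) z = 0 := by
  have hz : z ∈ ⨆ l, homog (Coord r) l := by rw [iSup_homog]; trivial
  induction hz using Submodule.iSup_induction' with
  | mem l a ha =>
    refine ⟨l + 1, fun T hT => ?_⟩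
    have key : ∀ k, (defect T ^ k) a ∈ wordFiltration r k l := by
      intro k
      induction k with
      | zero => simpa using homog_le_wordFiltration_zero l ha
      | succ k ih =>
        rw [pow_succ', Module.End.mul_apply]
        exact hT.defect_mem ih
    simpa [wordFiltration_eq_bot (r := r) (Nat.lt_succ_self l)] using key (l + 1)
  | zero => exact ⟨0, by simp⟩
  | add a b _ _ ha hb =>
    obtain ⟨k, hk⟩ := ha
    obtain ⟨k', hk'⟩ := hb
    refine ⟨k + k', fun T hT => ?_⟩
    rw [map_add, pow_add, Module.End.mul_apply, Module.End.mul_apply, hk' T hT, map_zero, add_zero,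
      ← Module.End.mul_apply, ← pow_add, add_comm, pow_add, Module.End.mul_apply, hk T hT, map_zero]

/-- The inverse of a unipotent endomorphism is a geometric series in its defect. -/
theorem apply_sum_defect_pow {T : GSym (Coord r) →ₐ[ℝ] GSym (Coord r)} {k : ℕ}
    {z : GSym (Coord r)} (h : (defect T ^ k) z = 0) :
    T (∑ j ∈ Finset.range k, (defect T ^ j) z) = z := by
  have h2 : (1 - defect T) * ∑ j ∈ Finset.range k, defect T ^ j = 1 - defect T ^ k :=
    mul_neg_geom_sum (defect T) k
  have h3 := DFunLike.congr_fun h2 z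
  rw [Module.End.mul_apply, LinearMap.sum_apply, LinearMap.sub_apply, LinearMap.sub_apply, h,
    defect_apply] at h3
  simpa using h3

theorem IsUnipotent.bijective {T : GSym (Coord r) →ₐ[ℝ] GSym (Coord r)} (hT : IsUnipotent T) :
    Function.Bijective T := by
  refine ⟨(injective_iff_map_eq_zero T).2 fun z hz => ?_, fun z => ?_⟩
  · obtain ⟨k, hk⟩ := exists_defect_pow_eq_zero z
    have key : ∀ k, (defect T ^ k) z = z := by
      intro k
      induction k with
      | zero => simp
      | succ k ih => rw [pow_succ', Module.End.mul_apply, ih, defect_apply, hz, sub_zero]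
    rw [← key k, hk T hT]
  · obtain ⟨k, hk⟩ := exists_defect_pow_eq_zero z
    exact ⟨_, apply_sum_defect_pow (hk T hT)⟩

end Unipotent

end GSym

/-! ### Germs of smooth functions with values in an algebra -/

section SmoothGerm

open Filter Topology

variable {m : ℕ} {M : Type u} [TopologicalSpace M] [ChartedSpace (EuclideanSpace ℝ (Fin m)) M]

variable (m) in
/-- The real function `g` is smooth in a neighbourhood of `y`. For `C^∞` this is stronger than
`ContMDiffAt` at `y`, where the neighbourhood may shrink with the order of differentiability. -/
def SmoothNear (g : M → ℝ) (y : M) : Prop :=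
  ∀ᶠ x in 𝓝 y, ContMDiffAt (𝓡 m) 𝓘(ℝ, ℝ) ∞ g x

namespace SmoothNear

variable {g g' : M → ℝ} {y : M}

theorem const (c : ℝ) : SmoothNear m (fun _ : M => c) y :=
  Eventually.of_forall fun _ => contMDiffAt_const

theorem add (h : SmoothNear m g y) (h' : SmoothNear m g' y) :
    SmoothNear m (fun x => g x + g' x) y := by
  filter_upwards [h, h'] with x hx hx' using hx.add hx'

theorem mul (h : SmoothNear m g y) (h' : SmoothNear m g' y) :
    SmoothNear m (fun x => g x * g' x) y := by
  filter_upwards [h, h'] with x hx hx' using hx.mul hx'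

theorem congr (h : SmoothNear m g y) (h' : g' =ᶠ[𝓝 y] g) : SmoothNear m g' y := by
  filter_upwards [h, h'.eventuallyEq_nhds] with x hx hx' using hx.congr_of_eventuallyEq hx'

theorem eventually (h : SmoothNear m g y) : ∀ᶠ x in 𝓝 y, SmoothNear m g x :=
  eventually_eventually_nhds.2 h

theorem exists_contMDiffMap (h : SmoothNear m g y) :
    ∃ (U : Opens M) (f : C^∞⟮𝓡 m, U; 𝓘(ℝ, ℝ), ℝ⟯), y ∈ U ∧ ∀ x : U, f x = g x := by
  obtain ⟨U, hU, hUo, hy⟩ := eventually_nhds_iff.1 h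
  exact ⟨⟨U, hUo⟩, ⟨fun x => g x, fun x => contMDiffAt_subtype_iff.2 (hU x x.2)⟩, hy,
    fun _ => rfl⟩

theorem of_contMDiffMap {U : Opens M} (f : C^∞⟮𝓡 m, U; 𝓘(ℝ, ℝ), ℝ⟯) (hy : y ∈ U)
    (h : ∀ x : U, f x = g x) : SmoothNear m g y := by
  filter_upwards [U.isOpen.mem_nhds hy] with x hx
  refine (contMDiffAt_subtype_iff (U := U) (x := ⟨x, hx⟩)).1 ?_
  exact (f.contMDiff ⟨x, hx⟩).congr_of_eventuallyEq (Eventually.of_forall fun x => (h x).symm)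

end SmoothNear

variable (m) in
/-- `f : M → A` is, in a neighbourhood of `y`, a finite sum `∑ g_k z_k` with smooth functions
`g_k` and constants `z_k ∈ A`: the germ of `f` at `y` lies in `C^∞ ⊗ A`. -/
inductive SmoothGerm {A : Type} [AddCommGroup A] [Module ℝ A] (y : M) : (M → A) → Prop
  | smul_const (g : M → ℝ) (z : A) (hg : SmoothNear m g y) : SmoothGerm y fun x => g x • z
  | add (f f' : M → A) (hf : SmoothGerm y f) (hf' : SmoothGerm y f') :
      SmoothGerm y fun x => f x + f' x
  | congr (f f' : M → A) (hf : SmoothGerm y f) (h : f' =ᶠ[𝓝 y] f) : SmoothGerm y f'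

namespace SmoothGerm

section Module

variable {A A' : Type} [AddCommGroup A] [Module ℝ A] [AddCommGroup A'] [Module ℝ A']
  {y : M} {f f' : M → A}

theorem const (z : A) : SmoothGerm m y fun _ : M => z := by
  simpa using smul_const (fun _ : M => (1 : ℝ)) z (SmoothNear.const 1)

theorem smul {g : M → ℝ} (hg : SmoothNear m g y) (hf : SmoothGerm m y f) :
    SmoothGerm m y fun x => g x • f x := by
  induction hf with
  | smul_const g' z hg' =>
    simpa only [mul_smul] using smul_const _ z (hg.mul hg')
  | add f f' _ _ h h' => simpa only [smul_add] using add _ _ h h'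
  | congr f f' _ h' h => exact congr _ _ h (h'.mono fun x hx => by simp only [hx])

theorem sub (hf : SmoothGerm m y f) (hf' : SmoothGerm m y f') :
    SmoothGerm m y fun x => f x - f' x := by
  have := add _ _ hf (smul (SmoothNear.const (-1)) hf')
  simpa [sub_eq_add_neg] using this

theorem sum {ι : Type*} (s : Finset ι) {f : ι → M → A} (h : ∀ i ∈ s, SmoothGerm m y (f i)) :
    SmoothGerm m y fun x => ∑ i ∈ s, f i x := by
  classical
  induction s using Finset.induction_on with
  | empty => simpa using const (m := m) (y := y) (0 : A)
  | insert a s ha ih =>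
    simp only [Finset.sum_insert ha]
    exact add _ _ (h a (Finset.mem_insert_self a s))
      (ih fun i hi => h i (Finset.mem_insert_of_mem hi))

theorem eventually (hf : SmoothGerm m y f) : ∀ᶠ x in 𝓝 y, SmoothGerm m x f := by
  induction hf with
  | smul_const g z hg => exact hg.eventually.mono fun x hx => smul_const _ _ hx
  | add f f' _ _ h h' => filter_upwards [h, h'] with x hx hx' using add _ _ hx hx'
  | congr f f' _ h' h =>
    filter_upwards [h, h'.eventuallyEq_nhds] with x hx hx' using congr _ _ hx hx'

/-- Linear functionals of smooth germs are smooth. -/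
theorem smoothNear_linear (ℓ : A →ₗ[ℝ] ℝ) (hf : SmoothGerm m y f) :
    SmoothNear m (fun x => ℓ (f x)) y := by
  induction hf with
  | smul_const g z hg => simpa using hg.mul (SmoothNear.const (ℓ z))
  | add f f' _ _ h h' => simpa using h.add h'
  | congr f f' _ h' h => exact h.congr (h'.mono fun x hx => by simp only [hx])

/-- A family of linear maps that is smooth on constants is smooth on smooth germs. -/
theorem apply_linear {L : M → A →ₗ[ℝ] A'} (hL : ∀ z, SmoothGerm m y fun x => L x z)
    (hf : SmoothGerm m y f) : SmoothGerm m y fun x => L x (f x) := by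
  induction hf with
  | smul_const g z hg => simpa using smul hg (hL z)
  | add f f' _ _ h h' => simpa using add _ _ h h'
  | congr f f' _ h' h => exact congr _ _ h (h'.mono fun x hx => by simp only [hx])

/-- A function with values in `ℝ^k` is a smooth germ if its coordinates are smooth. -/
theorem of_coord {k : ℕ} {f : M → Fin k → ℝ} (h : ∀ i, SmoothNear m (fun x => f x i) y) :
    SmoothGerm m y f := by
  have : f = fun x => ∑ i, f x i • (Pi.single i 1 : Fin k → ℝ) :=
    funext fun x => pi_eq_sum_univ' (f x)
  rw [this]
  exact sum _ fun i _ => smul_const _ _ (h i)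

end Module

theorem mul {A : Type} [Ring A] [Algebra ℝ A] {y : M} {f f' : M → A} (hf : SmoothGerm m y f)
    (hf' : SmoothGerm m y f') : SmoothGerm m y fun x => f x * f' x := by
  induction hf with
  | smul_const g z hg =>
    simpa using smul hg (apply_linear (L := fun _ => LinearMap.mulLeft ℝ z)
      (fun w => const (z * w)) hf')
  | add f₁ f₂ _ _ h₁ h₂ => simpa only [add_mul] using add _ _ h₁ h₂
  | congr f₁ f₂ _ h' h => exact congr _ _ h (h'.mono fun x hx => by simp only [hx])

section GSym

variable {n : ℕ} {r : Fin n → ℕ}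

/-- A family of algebra homomorphisms out of `Sym V` is smooth if it is smooth on generators. -/
theorem of_gen {V : Fin n → Type} [∀ i, AddCommGroup (V i)] [∀ i, Module ℝ (V i)]
    {A : Type} [Ring A] [Algebra ℝ A] {y : M} {T : M → GSym V →ₐ[ℝ] A}
    (hT : ∀ i v, SmoothGerm m y fun x => T x (GSym.gen V i v)) (z : GSym V) :
    SmoothGerm m y fun x => T x z := by
  induction z using GSym.monomial_induction with
  | hm L =>
    induction L with
    | nil => simpa [GSym.monomial] using const (m := m) (y := y) (1 : A)
    | cons p L ih =>
      have h1 : GSym.monomial V (p :: L) = GSym.gen V p.1 p.2 * GSym.monomial V L := by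
        simp [GSym.monomial]
      simpa only [h1, map_mul] using mul (hT _ _) ih
  | hadd a b ha hb => simpa only [map_add] using add _ _ ha hb
  | hsmul c a ha => simpa only [map_smul] using smul (SmoothNear.const c) ha

variable {V : Opens M}

theorem exists_mem_range {A : Type} [Ring A] [Algebra ℝ A] {y : M} {f : M → A}
    (hf : SmoothGerm m y f) :
    ∃ U : Opens M, y ∈ U ∧ ∃ t, ∀ x : U, evalTensor (m := m) A U t x = f x := by
  classical
  have hres : ∀ {U U' : Opens M} (h : U' ≤ U) (t : C^∞⟮𝓡 m, U; 𝓘(ℝ, ℝ), ℝ⟯ ⊗[ℝ] A),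
      ∃ t', ∀ x : U', evalTensor (m := m) A U' t' x = evalTensor A U t ⟨x, h x.2⟩ := by
    intro U U' h t
    induction t using TensorProduct.induction_on with
    | zero => exact ⟨0, by simp⟩
    | tmul g a =>
      refine ⟨ContMDiffMap.restrictRingHom (𝓡 m) 𝓘(ℝ, ℝ) ℝ h g ⊗ₜ a, fun x => ?_⟩
      rw [evalTensor_tmul, evalTensor_tmul]
      rfl
    | add t t' ht ht' =>
      obtain ⟨s, hs⟩ := ht
      obtain ⟨s', hs'⟩ := ht'
      exact ⟨s + s', fun x => by simp [hs, hs']⟩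
  induction hf with
  | smul_const g z hg =>
    obtain ⟨U, g', hy, hg'⟩ := hg.exists_contMDiffMap
    exact ⟨U, hy, g' ⊗ₜ z, fun x => by rw [evalTensor_tmul, hg']⟩
  | add f f' _ _ h h' =>
    obtain ⟨U, hy, t, ht⟩ := h
    obtain ⟨U', hy', t', ht'⟩ := h'
    obtain ⟨s, hs⟩ := hres (inf_le_left : U ⊓ U' ≤ U) t
    obtain ⟨s', hs'⟩ := hres (inf_le_right : U ⊓ U' ≤ U') t'
    exact ⟨U ⊓ U', ⟨hy, hy'⟩, s + s', fun x => by simp [hs, hs', ht, ht']⟩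
  | congr f f' _ h' h =>
    obtain ⟨U, hy, t, ht⟩ := h
    obtain ⟨U', hU', hUo, hy'⟩ := eventually_nhds_iff.1 h'
    obtain ⟨s, hs⟩ := hres (inf_le_left : U ⊓ ⟨U', hUo⟩ ≤ U) t
    exact ⟨U ⊓ ⟨U', hUo⟩, ⟨hy, hy'⟩, s, fun x => by rw [hs, ht, hU' _ x.2.2]⟩

/-- A function whose germs are smooth is a section of `C^∞ ⊗ Sym V`. -/
theorem mem_sections {f : M → GSym (GSym.Coord r)} (hf : ∀ x ∈ V, SmoothGerm m x f) :
    (fun x : V => f x) ∈ (modelPresheaf m M r).sections V := by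
  refine (SectionPresheaf.mem_sections _).2 fun x => ?_
  obtain ⟨U, hx, t, ht⟩ := (hf x x.2).exists_mem_range
  have h := (modelPresheaf m M r).S_res U (U ⊓ V) inf_le_left (fun x : U => f x)
    ⟨t, funext ht⟩
  exact ⟨U ⊓ V, ⟨hx, x.2⟩, inf_le_right, h⟩

/-- The germs of a section of `C^∞ ⊗ Sym V` are smooth. -/
theorem of_mem_sections {s : V → GSym (GSym.Coord r)} (hs : s ∈ (modelPresheaf m M r).sections V)
    {f : M → GSym (GSym.Coord r)} (hf : ∀ x : V, f x = s x) {y : M} (hy : y ∈ V) :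
    SmoothGerm m y f := by
  classical
  obtain ⟨U, hyU, hUV, t, ht⟩ := SectionPresheaf.mem_sections _ |>.1 hs ⟨y, hy⟩
  have ht' : ∀ x : U, f x = evalTensor (m := m) (GSym (GSym.Coord r)) U t x := fun x =>
    (hf ⟨x, hUV x.2⟩).trans (congrFun ht x).symm
  clear ht hs hf
  induction t using TensorProduct.induction_on generalizing f with
  | zero =>
    refine congr _ _ (const 0) ?_
    filter_upwards [U.isOpen.mem_nhds hyU] with x (hx : x ∈ U)
    simpa using ht' ⟨x, hx⟩
  | tmul g a =>
    let g' : M → ℝ := fun x => if hx : x ∈ U then g ⟨x, hx⟩ else 0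
    have hg' : SmoothNear m g' y :=
      SmoothNear.of_contMDiffMap g hyU fun x => by simp [g', x.2]
    refine congr _ _ (smul_const g' a hg') ?_
    filter_upwards [U.isOpen.mem_nhds hyU] with x (hx : x ∈ U)
    rw [ht' ⟨x, hx⟩, evalTensor_tmul]
    simp only [g', dif_pos hx]
  | add t t' h h' =>
    let ext := fun (t) (x : M) => if hx : x ∈ U then
      evalTensor (m := m) (GSym (GSym.Coord r)) U t ⟨x, hx⟩ else 0
    refine congr _ _ (add _ _ (h (f := ext t) fun x => ?_) (h' (f := ext t') fun x => ?_)) ?_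
    · simp [ext, x.2]
    · simp [ext, x.2]
    · filter_upwards [U.isOpen.mem_nhds hyU] with x (hx : x ∈ U)
      rw [ht' ⟨x, hx⟩, map_add]
      simp only [ext, dif_pos hx, Pi.add_apply]

end GSym

end SmoothGerm

end SmoothGerm

/-! ### Local trivializations as pointwise evaluations -/

namespace GradedAlgSheaf

section Restriction

variable {M : Type u} [TopologicalSpace M] (C : GradedAlgSheaf M)

theorem res_self {U : Opens M} (s : C.sec U) : C.res le_rfl s = s := by
  simp [res]

theorem res_res {U V W : Opens M} (h : V ≤ U) (h' : W ≤ V) (s : C.sec U) :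
    C.res h' (C.res h s) = C.res (h'.trans h) s := by
  have hc : (homOfLE (h'.trans h)).op = (homOfLE h).op ≫ (homOfLE h').op := rfl
  simp [res, hc]

theorem eq_of_locally_eq {V : Opens M} {s t : C.sec V}
    (h : ∀ x ∈ V, ∃ (U : Opens M) (hU : U ≤ V), x ∈ U ∧ C.res hU s = C.res hU t) : s = t := by
  choose! U hU hx hst using h
  refine TopCat.Sheaf.eq_of_locally_eq' C.sheaf (fun x : V => U x) V
    (fun x => homOfLE (hU x x.2)) (fun x hxV => ?_) s t fun x => hst x x.2
  exact Opens.mem_iSup.2 ⟨⟨x, hxV⟩, hx x hxV⟩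

theorem exists_gluing {ι : Type u} (U : ι → Opens M) (V : Opens M) (hU : ∀ i, U i ≤ V)
    (hV : V ≤ iSup U) (s : ∀ i, C.sec (U i))
    (h : ∀ i j, C.res (inf_le_left : U i ⊓ U j ≤ U i) (s i) =
      C.res (inf_le_right : U i ⊓ U j ≤ U j) (s j)) :
    ∃ t : C.sec V, ∀ i, C.res (hU i) t = s i :=
  (TopCat.Sheaf.existsUnique_gluing' C.sheaf U V (fun i => homOfLE (hU i)) hV s
    fun i j => h i j).exists

end Restriction

namespace IsoOn

open Filter Topology

section Groupoid

variable {M : Type u} [TopologicalSpace M] {C D E : GradedAlgSheaf M} {U : Opens M}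

/-- The inverse of an isomorphism. -/
def symm (e : C.IsoOn D U) : D.IsoOn C U where
  equiv V hV := (e.equiv V hV).symm
  naturality V V' hV h s := by
    obtain ⟨c, rfl⟩ := (e.equiv V hV).surjective s
    rw [← e.naturality V V' hV h c, AlgEquiv.symm_apply_apply, AlgEquiv.symm_apply_apply]
  mem_deg_iff V hV l s := by
    rw [← e.mem_deg_iff V hV, AlgEquiv.apply_symm_apply]

/-- The composition of isomorphisms. -/
def trans (e : C.IsoOn D U) (e' : D.IsoOn E U) : C.IsoOn E U where
  equiv V hV := (e.equiv V hV).trans (e'.equiv V hV)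
  naturality V V' hV h s := by
    rw [AlgEquiv.trans_apply, AlgEquiv.trans_apply, e.naturality V V' hV h, e'.naturality]
  mem_deg_iff V hV l s := by
    rw [AlgEquiv.trans_apply, e'.mem_deg_iff, e.mem_deg_iff]

/-- The restriction of an isomorphism to a smaller open set. -/
def mono (e : C.IsoOn D U) {U' : Opens M} (h : U' ≤ U) : C.IsoOn D U' where
  equiv V hV := e.equiv V (hV.trans h)
  naturality V V' hV := e.naturality V V' (hV.trans h)
  mem_deg_iff V hV := e.mem_deg_iff V (hV.trans h)

end Groupoid

variable {m n : ℕ} {M : Type u} [TopologicalSpace M] [ChartedSpace (EuclideanSpace ℝ (Fin m)) M]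
  {r : Fin n → ℕ}

variable (m r) in
/-- The values of a section of `C^∞ ⊗ Sym V`. -/
def modelVal (V : Opens M) : (modelSheaf m M r).sec V →ₐ[ℝ] (V → GSym (GSym.Coord r)) :=
  ((modelPresheaf m M r).sections V).val

theorem modelVal_injective (V : Opens M) : Function.Injective (modelVal m r V) :=
  Subtype.val_injective

variable {C : GradedAlgSheaf M} {U : Opens M} (φ : C.IsoOn (modelSheaf m M r) U)

/-- The value at `y` of a section of `C`, read in the local trivialization `φ`. -/
def evAt {V : Opens M} (y : M) (hV : y ∈ V) (hU : y ∈ U) : C.sec V →ₐ[ℝ] GSym (GSym.Coord r) :=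
  (Pi.evalAlgHom ℝ (fun _ : (V ⊓ U : Opens M) => GSym (GSym.Coord r)) ⟨y, hV, hU⟩).comp
    ((modelVal m r (V ⊓ U)).comp
      (((φ.equiv (V ⊓ U) inf_le_right) : C.sec (V ⊓ U) →ₐ[ℝ] _).comp (C.res inf_le_left)))

theorem evAt_apply {V : Opens M} {y : M} (hV : y ∈ V) (hU : y ∈ U) (c : C.sec V) :
    φ.evAt y hV hU c =
      modelVal m r (V ⊓ U) (φ.equiv (V ⊓ U) inf_le_right (C.res inf_le_left c)) ⟨y, hV, hU⟩ := rfl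

theorem evAt_eq {V V' : Opens M} (h : V' ≤ V) (h' : V' ≤ U) {y : M} (hy : y ∈ V') (c : C.sec V) :
    φ.evAt y (h hy) (h' hy) c = modelVal m r V' (φ.equiv V' h' (C.res h c)) ⟨y, hy⟩ := by
  rw [evAt_apply, ← C.res_res inf_le_left (le_inf h h'), φ.naturality _ _ inf_le_right]
  rfl

theorem evAt_res {V V' : Opens M} (h : V' ≤ V) {y : M} (hy : y ∈ V') (hU : y ∈ U) (c : C.sec V) :
    φ.evAt y hy hU (C.res h c) = φ.evAt y (h hy) hU c := by
  rw [evAt_apply, C.res_res]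
  exact (φ.evAt_eq (inf_le_left.trans h) inf_le_right (V' := V' ⊓ U) ⟨hy, hU⟩ c).symm

open Classical in
/-- The function on `M` with values `φ.evAt y c`, extended by zero. -/
def ev {V : Opens M} (c : C.sec V) (y : M) : GSym (GSym.Coord r) :=
  if h : y ∈ V ∧ y ∈ U then φ.evAt y h.1 h.2 c else 0

theorem ev_eq {V : Opens M} (c : C.sec V) {y : M} (hV : y ∈ V) (hU : y ∈ U) :
    φ.ev c y = φ.evAt y hV hU c := dif_pos ⟨hV, hU⟩

theorem smoothGerm_ev {V : Opens M} (c : C.sec V) {y : M} (hV : y ∈ V) (hU : y ∈ U) :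
    SmoothGerm m y (φ.ev c) :=
  SmoothGerm.of_mem_sections (V := V ⊓ U)
    (φ.equiv (V ⊓ U) inf_le_right (C.res inf_le_left c)).2
    (fun x => φ.ev_eq c x.2.1 x.2.2) ⟨hV, hU⟩

theorem exists_sec {V : Opens M} (hVU : V ≤ U) {f : M → GSym (GSym.Coord r)}
    (hf : ∀ x ∈ V, SmoothGerm m x f) :
    ∃ c : C.sec V, ∀ y (hy : y ∈ V), φ.evAt y hy (hVU hy) c = f y := by
  let s : (modelSheaf m M r).sec V := ⟨fun x : V => f x, SmoothGerm.mem_sections hf⟩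
  refine ⟨(φ.equiv V hVU).symm s, fun y hy => ?_⟩
  rw [φ.evAt_eq le_rfl hVU hy, C.res_self, AlgEquiv.apply_symm_apply]
  rfl

theorem sec_ext {V : Opens M} (hVU : V ≤ U) {c c' : C.sec V}
    (h : ∀ y (hy : y ∈ V), φ.evAt y hy (hVU hy) c = φ.evAt y hy (hVU hy) c') : c = c' := by
  refine (φ.equiv V hVU).injective (modelVal_injective V (funext fun y => ?_))
  have := h y y.2
  rwa [φ.evAt_eq le_rfl hVU y.2, φ.evAt_eq le_rfl hVU y.2, C.res_self, C.res_self] at this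

theorem mem_deg_iff_evAt {V : Opens M} (hVU : V ≤ U) (l : ℕ) (c : C.sec V) :
    c ∈ C.deg V l ↔ ∀ y (hy : y ∈ V), φ.evAt y hy (hVU hy) c ∈ GSym.homog (GSym.Coord r) l := by
  rw [← φ.mem_deg_iff V hVU]
  refine ((modelPresheaf m M r).mem_degree).trans ⟨fun h y hy => ?_, fun h y => ?_⟩
  · rw [φ.evAt_eq le_rfl hVU hy, C.res_self]
    exact h ⟨y, hy⟩
  · have := h y y.2
    rwa [φ.evAt_eq le_rfl hVU y.2, C.res_self] at this

theorem evAt_mem_homog {V : Opens M} {l : ℕ} {c : C.sec V} (hc : c ∈ C.deg V l) {y : M}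
    (hV : y ∈ V) (hU : y ∈ U) : φ.evAt y hV hU c ∈ GSym.homog (GSym.Coord r) l := by
  have h := (φ.mem_deg_iff_evAt (inf_le_right : V ⊓ U ≤ U) l _).1
    (C.res_mem V (V ⊓ U) inf_le_left l c hc) y ⟨hV, hU⟩
  exact (φ.evAt_res inf_le_left ⟨hV, hU⟩ hU c) ▸ h

variable (m r) in
/-- The constant sections of `C^∞ ⊗ Sym V`. -/
def modelConst (U : Opens M) : GSym (GSym.Coord r) →ₐ[ℝ] (modelSheaf m M r).sec U where
  toFun z := ⟨fun _ => z, SmoothGerm.mem_sections fun _ _ => SmoothGerm.const z⟩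
  map_one' := rfl
  map_mul' _ _ := rfl
  map_zero' := rfl
  map_add' _ _ := rfl
  commutes' _ := rfl

/-- The section of `C` that is constant in the trivialization `φ`. -/
def constSec : GSym (GSym.Coord r) →ₐ[ℝ] C.sec U :=
  ((φ.equiv U le_rfl).symm : _ →ₐ[ℝ] C.sec U).comp (modelConst m r U)

theorem evAt_constSec {y : M} (hU : y ∈ U) (z : GSym (GSym.Coord r)) :
    φ.evAt y hU hU (φ.constSec z) = z := by
  have h : φ.constSec z = (φ.equiv U le_rfl).symm (modelConst m r U z) := rfl
  rw [φ.evAt_eq le_rfl le_rfl hU, C.res_self, h, AlgEquiv.apply_symm_apply]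
  rfl

/-! ### Transition automorphisms -/

variable {U' U'' : Opens M} (φ' : C.IsoOn (modelSheaf m M r) U')
  (φ'' : C.IsoOn (modelSheaf m M r) U'')

/-- A section that is a smooth scalar function in one trivialization, with nonzero value at `y`, is
invertible near `y`. -/
theorem exists_isUnit_res {V : Opens M} (hVU : V ≤ U) {c : C.sec V} {g : M → ℝ} {y : M}
    (hy : y ∈ V) (hg : SmoothNear m g y) (hgy : g y ≠ 0)
    (hc : ∀ x (hx : x ∈ V), φ.evAt x hx (hVU hx) c = algebraMap ℝ _ (g x)) :
    ∃ (V' : Opens M) (h : V' ≤ V), y ∈ V' ∧ IsUnit (C.res h c) := by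
  have hcont : ContinuousAt g y := hg.self_of_nhds.continuousAt
  obtain ⟨W, hW, hWo, hyW⟩ := eventually_nhds_iff.1 (hg.and (hcont.eventually_ne hgy))
  let V' : Opens M := V ⊓ ⟨W, hWo⟩
  have hV' : V' ≤ V := inf_le_left
  have hsm : ∀ x ∈ V', SmoothGerm m x fun x => (g x)⁻¹ • (1 : GSym (GSym.Coord r)) := by
    intro x hx
    refine SmoothGerm.smul_const _ _ ?_
    filter_upwards [hWo.mem_nhds hx.2] with x' hx'
    exact (hW x' hx').1.inv₀ (hW x' hx').2
  obtain ⟨d, hd⟩ := φ.exists_sec (hV'.trans hVU) hsm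
  refine ⟨V', hV', ⟨hy, hyW⟩, ?_⟩
  have hval : ∀ x (hx : x ∈ V'), φ.evAt x hx (hVU (hV' hx)) (C.res hV' c) =
      algebraMap ℝ _ (g x) := fun x hx => by rw [φ.evAt_res, hc]
  have h1 : C.res hV' c * d = 1 := φ.sec_ext (hV'.trans hVU) fun x hx => by
    rw [map_mul, hd x hx, hval x hx, map_one]
    simp [Algebra.algebraMap_eq_smul_one, smul_smul, (hW x hx.2).2]
  have h2 : d * C.res hV' c = 1 := φ.sec_ext (hV'.trans hVU) fun x hx => by
    rw [map_mul, hd x hx, hval x hx, map_one]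
    simp [Algebra.algebraMap_eq_smul_one, smul_smul, (hW x hx.2).2]
  exact ⟨⟨C.res hV' c, d, h1, h2⟩, rfl⟩

/-- Isomorphisms of sheaves of algebras over the identity of `M` respect smooth functions: a real
number `t` is the value of a function `g` at `y` exactly if `g - t` is not invertible near `y`. -/
theorem evAt_eq_of_scalar {V : Opens M} (hVU : V ≤ U) {c : C.sec V} {g : M → ℝ} {y : M}
    (hy : y ∈ V) (hU' : y ∈ U') (hg : SmoothNear m g y)
    (hc : ∀ x (hx : x ∈ V), φ.evAt x hx (hVU hx) c = algebraMap ℝ _ (g x)) :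
    φ'.evAt y hy hU' c = algebraMap ℝ _ (g y) := by
  have hdeg : c ∈ C.deg V 0 := (φ.mem_deg_iff_evAt hVU 0 c).2 fun x hx => by
    rw [hc x hx, Algebra.algebraMap_eq_smul_one]
    exact Submodule.smul_mem _ _ (GSym.gradedMonoid _).one_mem
  obtain ⟨t, ht⟩ := GSym.mem_homog_zero (φ'.evAt_mem_homog hdeg hy hU')
  rw [ht]
  congr 1
  by_contra hne
  have hc' : ∀ x (hx : x ∈ V), φ.evAt x hx (hVU hx) (c + algebraMap ℝ _ (-t)) =
      algebraMap ℝ _ (g x + -t) := fun x hx => by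
    rw [map_add, hc x hx, AlgHom.commutes, map_add]
  obtain ⟨V', hV', hyV', hu⟩ := φ.exists_isUnit_res hVU hy (hg.add (SmoothNear.const (-t)))
    (fun h => hne (by linarith)) hc'
  have h0 := ((hu.map (φ'.evAt y hyV' hU')).map (GSym.aug r))
  rw [φ'.evAt_res, map_add, ht, AlgHom.commutes, ← map_add, add_neg_cancel, map_zero,
    map_zero] at h0
  exact not_isUnit_zero h0

open Classical in
/-- The transition `Sym V → Sym V` at `y` from the trivialization `φ` to the trivialization `φ'`;
by convention it is the identity where one of the two is not defined. -/
def transition (y : M) : GSym (GSym.Coord r) →ₐ[ℝ] GSym (GSym.Coord r) :=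
  if h : y ∈ U ∧ y ∈ U' then (φ'.evAt y h.1 h.2).comp φ.constSec else AlgHom.id ℝ _

theorem transition_apply {y : M} (hU : y ∈ U) (hU' : y ∈ U') (z : GSym (GSym.Coord r)) :
    φ.transition φ' y z = φ'.evAt y hU hU' (φ.constSec z) := by
  rw [transition, dif_pos ⟨hU, hU'⟩]
  rfl

/-- The transition relates the values of all sections: sections are locally sums of constant
sections with smooth functions as coefficients. -/
theorem transition_evAt {V : Opens M} (c : C.sec V) {y : M} (hV : y ∈ V) (hU : y ∈ U)
    (hU' : y ∈ U') : φ.transition φ' y (φ.evAt y hV hU c) = φ'.evAt y hV hU' c := by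
  suffices h : ∀ f : M → GSym (GSym.Coord r), SmoothGerm m y f → ∀ (V : Opens M) (hV : y ∈ V)
      (c : C.sec V), (∀ x (hx : x ∈ V) (hxU : x ∈ U), φ.evAt x hx hxU c = f x) →
      φ.transition φ' y (f y) = φ'.evAt y hV hU' c by
    rw [← h _ (φ.smoothGerm_ev c hV hU) V hV c fun x hx hxU => (φ.ev_eq c hx hxU).symm,
      φ.ev_eq c hV hU]
  intro f hf
  induction hf with
  | smul_const g z hg =>
    intro V hV c hc
    obtain ⟨W, hW, hWo, hyW⟩ := eventually_nhds_iff.1 hg.eventually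
    let V' : Opens M := V ⊓ U ⊓ ⟨W, hWo⟩
    have hyV' : y ∈ V' := ⟨⟨hV, hU⟩, hyW⟩
    have hV'V : V' ≤ V := inf_le_left.trans inf_le_left
    have hV'U : V' ≤ U := inf_le_left.trans inf_le_right
    obtain ⟨d, hd⟩ := φ.exists_sec hV'U (f := fun x => g x • (1 : GSym (GSym.Coord r)))
      fun x hx => SmoothGerm.smul_const _ _ (hW x hx.2)
    have hcd : C.res hV'V c = d * C.res hV'U (φ.constSec z) :=
      φ.sec_ext hV'U fun x hx => by
        rw [φ.evAt_res, hc x, map_mul, hd x hx, φ.evAt_res hV'U hx, φ.evAt_constSec,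
          smul_mul_assoc, one_mul]
    have hd' := φ.evAt_eq_of_scalar φ' hV'U hyV' hU' hg fun x hx => by
      rw [hd x hx, Algebra.algebraMap_eq_smul_one]
    rw [← φ'.evAt_res hV'V hyV' hU', hcd, map_mul, hd', φ'.evAt_res, map_smul,
      φ.transition_apply φ' hU hU', Algebra.smul_def]
  | add f f' hf hf' h h' =>
    intro V hV c hc
    obtain ⟨W, hW, hWo, hyW⟩ := eventually_nhds_iff.1 (hf.eventually.and hf'.eventually)
    let V' : Opens M := V ⊓ U ⊓ ⟨W, hWo⟩
    have hyV' : y ∈ V' := ⟨⟨hV, hU⟩, hyW⟩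
    have hV'V : V' ≤ V := inf_le_left.trans inf_le_left
    have hV'U : V' ≤ U := inf_le_left.trans inf_le_right
    obtain ⟨d, hd⟩ := φ.exists_sec hV'U fun x hx => (hW x hx.2).1
    obtain ⟨d', hd'⟩ := φ.exists_sec hV'U fun x hx => (hW x hx.2).2
    have hcd : C.res hV'V c = d + d' := φ.sec_ext hV'U fun x hx => by
      rw [φ.evAt_res, hc x, map_add, hd x hx, hd' x hx]
    rw [map_add, h V' hyV' d fun x hx _ => hd x hx, h' V' hyV' d' fun x hx _ => hd' x hx,
      ← map_add, ← hcd, φ'.evAt_res]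
  | congr f f' hf hff' h =>
    intro V hV c hc
    obtain ⟨W, hW, hWo, hyW⟩ := eventually_nhds_iff.1 hff'
    let V' : Opens M := V ⊓ ⟨W, hWo⟩
    have hyV' : y ∈ V' := ⟨hV, hyW⟩
    have hV' : V' ≤ V := inf_le_left
    rw [hff'.eq_of_nhds, h V' hyV' (C.res hV' c) fun x hx hxU => by
      rw [φ.evAt_res, hc x, hW x hx.2], φ'.evAt_res]

theorem transition_self {y : M} (hU : y ∈ U) (z : GSym (GSym.Coord r)) :
    φ.transition φ y z = z := by
  rw [transition_apply φ φ hU hU, evAt_constSec]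

theorem transition_transition {y : M} (hU : y ∈ U) (hU' : y ∈ U') (hU'' : y ∈ U'')
    (z : GSym (GSym.Coord r)) :
    φ'.transition φ'' y (φ.transition φ' y z) = φ.transition φ'' y z := by
  rw [transition_apply φ φ' hU hU', transition_evAt φ' φ'' _ hU hU' hU'',
    transition_apply φ φ'' hU hU'']

theorem isGraded_transition (y : M) : GSym.IsGraded (φ.transition φ' y) := by
  intro l z hz
  by_cases h : y ∈ U ∧ y ∈ U'
  · rw [transition_apply φ φ' h.1 h.2]
    refine φ'.evAt_mem_homog ((φ.mem_deg_iff_evAt le_rfl l _).2 fun x hx => ?_) h.1 h.2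
    rwa [evAt_constSec]
  · rwa [transition, dif_neg h]

theorem smoothGerm_transition {y : M} (hU : y ∈ U) (hU' : y ∈ U') (z : GSym (GSym.Coord r)) :
    SmoothGerm m y fun x => φ.transition φ' x z := by
  refine SmoothGerm.congr _ _ (φ'.smoothGerm_ev (φ.constSec z) hU hU') ?_
  filter_upwards [U.isOpen.mem_nhds hU, U'.isOpen.mem_nhds hU'] with x hx hx'
  rw [transition_apply φ φ' hx hx', ev_eq]

end IsoOn

end GradedAlgSheaf

/-! ### The bundle of linear parts -/

open Filter Topology

section Bundle

variable {m n : ℕ} {M : Type u} [TopologicalSpace M] [ChartedSpace (EuclideanSpace ℝ (Fin m)) M]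

variable (m) in
/-- A trivialization of `C` around every point of `M`, with a subordinate partition of unity. The
trivializations are indexed by the points of `M`. -/
structure TrivializationAtlas (C : GradedAlgSheaf M) (r : Fin n → ℕ) where
  /-- The domain of the trivialization with index `a`. -/
  dom : M → Opens M
  mem_dom : ∀ a, a ∈ dom a
  /-- The trivialization with index `a`. -/
  triv : ∀ a, C.IsoOn (modelSheaf m M r) (dom a)
  /-- The partition of unity. -/
  partition : SmoothPartitionOfUnity M (𝓡 m) M Set.univ
  subordinate : partition.IsSubordinate fun a => (dom a : Set M)

namespace TrivializationAtlas

variable {C : GradedAlgSheaf M} {r : Fin n → ℕ} (A : TrivializationAtlas m C r)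

/-- The transition automorphism of `Sym V` at `y` from the index `a` to the index `b`. -/
def trans (a b y : M) : GSym (GSym.Coord r) →ₐ[ℝ] GSym (GSym.Coord r) :=
  (A.triv a).transition (A.triv b) y

/-- The linear part of the transition automorphism. -/
def linTrans (a b : M) (i : Fin n) (y : M) : GSym.Coord r i →ₗ[ℝ] GSym.Coord r i :=
  GSym.linPart (A.trans a b y) i

theorem trans_self {a y : M} (ha : y ∈ A.dom a) (z : GSym (GSym.Coord r)) :
    A.trans a a y z = z := GradedAlgSheaf.IsoOn.transition_self _ ha z

theorem trans_trans {a b c y : M} (ha : y ∈ A.dom a) (hb : y ∈ A.dom b) (hc : y ∈ A.dom c)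
    (z : GSym (GSym.Coord r)) : A.trans b c y (A.trans a b y z) = A.trans a c y z :=
  GradedAlgSheaf.IsoOn.transition_transition _ _ _ ha hb hc z

theorem isGraded_trans (a b y : M) : GSym.IsGraded (A.trans a b y) :=
  GradedAlgSheaf.IsoOn.isGraded_transition _ _ y

theorem smoothGerm_trans {a b y : M} (ha : y ∈ A.dom a) (hb : y ∈ A.dom b)
    (z : GSym (GSym.Coord r)) : SmoothGerm m y fun x => A.trans a b x z :=
  GradedAlgSheaf.IsoOn.smoothGerm_transition _ _ ha hb z

theorem linTrans_self {a y : M} (ha : y ∈ A.dom a) (i : Fin n) (v : GSym.Coord r i) :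
    A.linTrans a a i y v = v := by
  rw [linTrans, GSym.linPart_apply, A.trans_self ha, GSym.lin_gen_same]

theorem linTrans_linTrans {a b c y : M} (ha : y ∈ A.dom a) (hb : y ∈ A.dom b) (hc : y ∈ A.dom c)
    (i : Fin n) (v : GSym.Coord r i) :
    A.linTrans b c i y (A.linTrans a b i y v) = A.linTrans a c i y v := by
  rw [linTrans, linTrans, GSym.linPart_apply (A.trans a b y), ← (A.isGraded_trans b c y).lin_apply,
    A.trans_trans ha hb hc]
  rfl

theorem smoothNear_linTrans {a b y : M} (ha : y ∈ A.dom a) (hb : y ∈ A.dom b) (i : Fin n)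
    (v : GSym.Coord r i) (k : Fin (r i)) : SmoothNear m (fun x => A.linTrans a b i x v k) y :=
  (A.smoothGerm_trans ha hb (GSym.gen _ i v)).smoothNear_linear
    (LinearMap.proj (φ := fun _ : Fin (r i) => ℝ) k ∘ₗ GSym.lin r i)

theorem smoothGerm_linTrans {a b y : M} (ha : y ∈ A.dom a) (hb : y ∈ A.dom b) (i : Fin n)
    (v : GSym.Coord r i) : SmoothGerm m y fun x => A.linTrans a b i x v :=
  SmoothGerm.of_coord fun k => A.smoothNear_linTrans ha hb i v k

/-- The linear parts of the transition automorphisms as continuous linear maps. -/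
def coordChange (i : Fin n) (a b y : M) : GSym.Coord r i →L[ℝ] GSym.Coord r i :=
  LinearMap.toContinuousLinearMap (A.linTrans a b i y)

theorem coordChange_apply (i : Fin n) (a b y : M) (v : GSym.Coord r i) :
    A.coordChange i a b y v = A.linTrans a b i y v := rfl

theorem contMDiffOn_coordChange (i : Fin n) (a b : M) :
    ContMDiffOn (𝓡 m) 𝓘(ℝ, GSym.Coord r i →L[ℝ] GSym.Coord r i) ∞ (A.coordChange i a b)
      ((A.dom a : Set M) ∩ A.dom b) := by
  intro y hy
  refine ContMDiffAt.contMDiffWithinAt ?_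
  -- A linear map on `ℝ^k` is the sum over `k` of its values on the standard basis.
  have h : A.coordChange i a b = fun x => ∑ k, ContinuousLinearMap.smulRightL ℝ _ _
      (ContinuousLinearMap.proj (R := ℝ) (φ := fun _ : Fin (r i) => ℝ) k)
      (A.linTrans a b i x (Pi.single k 1)) := by
    funext x
    ext v k
    rw [coordChange_apply]
    conv_lhs => rw [pi_eq_sum_univ' v, map_sum]
    simp
  rw [h]
  refine ContMDiffAt.sum fun k _ => ?_
  refine (ContinuousLinearMap.contMDiff _).contMDiffAt.comp y ?_
  exact contMDiffAt_pi_space.2 fun l =>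
    (A.smoothNear_linTrans hy.1 hy.2 i (Pi.single k 1) l).self_of_nhds

/-- The vector bundle with transition functions the linear parts of the transition
automorphisms, in degree `i + 1`. -/
def core (i : Fin n) : VectorBundleCore ℝ M (GSym.Coord r i) M where
  baseSet a := A.dom a
  isOpen_baseSet a := (A.dom a).isOpen
  indexAt x := x
  mem_baseSet_at := A.mem_dom
  coordChange := A.coordChange i
  coordChange_self _ _ hx v := A.linTrans_self hx i v
  continuousOn_coordChange a b := (A.contMDiffOn_coordChange i a b).continuousOn
  coordChange_comp _ _ _ _ hx v := A.linTrans_linTrans hx.1.1 hx.1.2 hx.2 i v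

instance (i : Fin n) : (A.core i).IsContMDiff (𝓡 m) ∞ :=
  ⟨A.contMDiffOn_coordChange i⟩

/-- The graded vector bundle of linear parts. Its fibre at `y` is `V`, in the coordinates of the
trivialization with index `y`. -/
def bundle : GradedVectorBundle m n M where
  rank := r
  fiber i := (A.core i).Fiber

/-- The coordinates of a vector of the bundle in the trivialization with index `a`. -/
def fiberCoord (a y : M) (i : Fin n) : A.bundle.fiber i y →ₗ[ℝ] GSym.Coord r i :=
  A.linTrans y a i y

/-- The vector of the bundle with given coordinates in the trivialization with index `a`. -/
def fiberVec (a y : M) (i : Fin n) : GSym.Coord r i →ₗ[ℝ] A.bundle.fiber i y :=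
  A.linTrans a y i y

theorem fiberCoord_fiberVec {a y : M} (ha : y ∈ A.dom a) (i : Fin n) (v : GSym.Coord r i) :
    A.fiberCoord a y i (A.fiberVec a y i v) = v :=
  (A.linTrans_linTrans ha (A.mem_dom y) ha i v).trans (A.linTrans_self ha i v)

theorem fiberVec_fiberCoord {a y : M} (ha : y ∈ A.dom a) (i : Fin n)
    (w : A.bundle.fiber i y) : A.fiberVec a y i (A.fiberCoord a y i w) = w :=
  (A.linTrans_linTrans (A.mem_dom y) ha (A.mem_dom y) i w).trans
    (A.linTrans_self (A.mem_dom y) i w)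

theorem linTrans_fiberCoord {a b y : M} (ha : y ∈ A.dom a) (hb : y ∈ A.dom b) (i : Fin n)
    (w : A.bundle.fiber i y) :
    A.linTrans a b i y (A.fiberCoord a y i w) = A.fiberCoord b y i w :=
  A.linTrans_linTrans (A.mem_dom y) ha hb i w

theorem contMDiffAt_section_core_iff {a y : M} (ha : y ∈ A.dom a) (i : Fin n)
    (w : ∀ x, (A.core i).Fiber x) :
    ContMDiffAt (𝓡 m) ((𝓡 m).prod 𝓘(ℝ, GSym.Coord r i)) ∞
        (fun x => Bundle.TotalSpace.mk' (GSym.Coord r i) x (w x)) y ↔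
      ContMDiffAt (𝓡 m) 𝓘(ℝ, GSym.Coord r i) ∞ (fun x => A.linTrans x a i x (w x)) y :=
  haveI : MemTrivializationAtlas ((A.core i).localTriv a) := ⟨⟨a, rfl⟩⟩
  ((A.core i).localTriv a).contMDiffAt_section_iff ha

theorem contMDiffAt_section_iff {a y : M} (ha : y ∈ A.dom a) (i : Fin n)
    (w : ∀ x, A.bundle.fiber i x) :
    ContMDiffAt (𝓡 m) ((𝓡 m).prod 𝓘(ℝ, Fin (A.bundle.rank i) → ℝ)) ∞
        (fun x => Bundle.TotalSpace.mk' (Fin (A.bundle.rank i) → ℝ) x (w x)) y ↔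
      ContMDiffAt (𝓡 m) 𝓘(ℝ, GSym.Coord r i) ∞ (fun x => A.fiberCoord a x i (w x)) y :=
  A.contMDiffAt_section_core_iff ha i w

theorem smoothGerm_fiberCoord {a y : M} (ha : y ∈ A.dom a) {i : Fin n} {V : Opens M} (hy : y ∈ V)
    {w : ∀ x, A.bundle.fiber i x} (hw : A.bundle.IsSmoothSection i V w) :
    SmoothGerm m y fun x => A.fiberCoord a x i (w x) := by
  refine SmoothGerm.of_coord fun k => ?_
  filter_upwards [V.isOpen.mem_nhds hy, (A.dom a).isOpen.mem_nhds ha] with x hx hxa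
  have h := (A.contMDiffAt_section_iff hxa i w).1 ((hw x hx).contMDiffAt (V.isOpen.mem_nhds hx))
  exact contMDiffAt_pi_space.1 h k

theorem isSmoothSection_fiberVec (a : M) (i : Fin n) (v : GSym.Coord r i) :
    A.bundle.IsSmoothSection i (A.dom a) fun x => A.fiberVec a x i v := by
  intro y hy
  refine ((A.contMDiffAt_section_iff hy i _).2 ?_).contMDiffWithinAt
  refine (contMDiffAt_const (c := v)).congr_of_eventuallyEq ?_
  filter_upwards [(A.dom a).isOpen.mem_nhds hy] with x hx using A.fiberCoord_fiberVec hx i v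

/-! ### Sections of the symmetric algebra bundle in coordinates -/

/-- The coordinates of an element of `Sym W_y` in the trivialization with index `a`. -/
def symCoord (a y : M) : (GSym fun i => A.bundle.fiber i y) →ₐ[ℝ] GSym (GSym.Coord r) :=
  GSym.map (A.fiberCoord a y)

/-- The element of `Sym W_y` with given coordinates in the trivialization with index `a`. -/
def symVec (a y : M) : GSym (GSym.Coord r) →ₐ[ℝ] (GSym fun i => A.bundle.fiber i y) :=
  GSym.map (A.fiberVec a y)

theorem symCoord_symVec {a y : M} (ha : y ∈ A.dom a) (z : GSym (GSym.Coord r)) :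
    A.symCoord a y (A.symVec a y z) = z :=
  GSym.map_map_of_leftInverse _ _ (A.fiberCoord_fiberVec ha) z

theorem symVec_symCoord {a y : M} (ha : y ∈ A.dom a) (z : GSym fun i => A.bundle.fiber i y) :
    A.symVec a y (A.symCoord a y z) = z :=
  GSym.map_map_of_leftInverse _ _ (A.fiberVec_fiberCoord ha) z

/-- The coordinates of a section of `Sym W` are smooth. -/
theorem smoothGerm_symCoord {a y : M} (ha : y ∈ A.dom a) {U : Opens M} (hy : y ∈ U)
    {s : ∀ x : U, GSym fun i => A.bundle.fiber i x} (hs : s ∈ A.bundle.polynomialSections U)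
    {f : M → GSym (GSym.Coord r)} (hf : ∀ x : U, f x = A.symCoord a x (s x)) :
    SmoothGerm m y f := by
  classical
  have key : ∀ {f g : M → GSym (GSym.Coord r)}, SmoothGerm m y g → (∀ x : U, f x = g x) →
      SmoothGerm m y f := fun {f g} hg h => SmoothGerm.congr _ _ hg (by
    filter_upwards [U.isOpen.mem_nhds hy] with x hx using h ⟨x, hx⟩)
  have scalar : ∀ c : ℝ, (algebraMap ℝ (GSym (GSym.Coord r))) c = c • 1 :=
    fun c => Algebra.algebraMap_eq_smul_one c
  let ext : (∀ x : U, GSym fun i => A.bundle.fiber i x) → M → GSym (GSym.Coord r) :=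
    fun s x => if hx : x ∈ U then A.symCoord a x (s ⟨x, hx⟩) else 0
  have hext : ∀ s (x : U), ext s x = A.symCoord a x (s x) := fun s x => by simp [ext, x.2]
  induction hs using Algebra.adjoin_induction generalizing f with
  | mem s hs =>
    rcases hs with ⟨g, rfl⟩ | ⟨i, w, hw, rfl⟩
    · let g' : M → ℝ := fun x => if hx : x ∈ U then g ⟨x, hx⟩ else 0
      have hg' : ∀ x : U, g' x = g x := fun x => by simp [g', x.2]
      refine key (SmoothGerm.smul_const g' 1
        (SmoothNear.of_contMDiffMap g hy fun x => (hg' x).symm)) fun x => ?_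
      rw [hf, AlgHom.commutes, hg', scalar]
    · refine key (SmoothGerm.apply_linear (L := fun _ => GSym.gen (GSym.Coord r) i)
        (fun z => SmoothGerm.const _) (A.smoothGerm_fiberCoord ha hy hw)) fun x => ?_
      rw [hf]
      exact GSym.map_gen _ i _
  | algebraMap c =>
    refine key (SmoothGerm.const (algebraMap ℝ _ c)) fun x => ?_
    rw [hf]
    exact AlgHom.commutes _ c
  | add s t _ _ hs ht =>
    refine key (SmoothGerm.add _ _ (hs (hext s)) (ht (hext t))) fun x => ?_
    rw [hf, hext, hext]
    exact map_add _ _ _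
  | mul s t _ _ hs ht =>
    refine key (SmoothGerm.mul (hs (hext s)) (ht (hext t))) fun x => ?_
    rw [hf, hext, hext]
    exact map_mul _ _ _

/-- Constants in a trivialization are polynomial in the sections of its frame. -/
theorem symVec_mem_polynomialSections (a : M) (z : GSym (GSym.Coord r)) :
    (fun x : A.dom a => A.symVec a x z) ∈ A.bundle.polynomialSections (A.dom a) := by
  induction z using GSym.monomial_induction with
  | hm L =>
    induction L with
    | nil =>
      have h : (fun x : A.dom a => A.symVec a x (GSym.monomial _ [])) = 1 :=
        funext fun x => by simp [GSym.monomial]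
      rw [h]
      exact Subalgebra.one_mem _
    | cons p L ih =>
      have h : (fun x : A.dom a => A.symVec a x (GSym.monomial _ (p :: L))) =
          (fun x : A.dom a => GSym.gen (fun i => A.bundle.fiber i x) p.1 (A.fiberVec a x p.1 p.2)) *
            fun x : A.dom a => A.symVec a x (GSym.monomial _ L) := by
        funext x
        have h1 : GSym.monomial _ (p :: L) =
            GSym.gen (GSym.Coord r) p.1 p.2 * GSym.monomial _ L := by simp [GSym.monomial]
        rw [h1, map_mul, Pi.mul_apply]
        congr 1
        exact GSym.map_gen _ _ _
      rw [h]
      exact Subalgebra.mul_mem _ (Algebra.subset_adjoin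
        (Or.inr ⟨p.1, _, A.isSmoothSection_fiberVec a p.1 p.2, rfl⟩)) ih
  | hadd b c hb hc => simpa only [map_add] using! Subalgebra.add_mem _ hb hc
  | hsmul t b hb => simpa only [map_smul] using! Subalgebra.smul_mem _ hb t

/-- The sections of `Sym W` with smooth coordinates are smooth. -/
theorem exists_symVec_mem_polynomialSections {a y : M} (ha : y ∈ A.dom a)
    {f : M → GSym (GSym.Coord r)} (hf : SmoothGerm m y f) :
    ∃ U : Opens M, y ∈ U ∧
      (fun x : U => A.symVec a x (f x)) ∈ A.bundle.polynomialSections U := by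
  have hres : ∀ {U V : Opens M} (h : V ≤ U) {f : M → GSym (GSym.Coord r)},
      (fun x : U => A.symVec a x (f x)) ∈ A.bundle.polynomialSections U →
      (fun x : V => A.symVec a x (f x)) ∈ A.bundle.polynomialSections V :=
    fun {U V} h f hf => A.bundle.symPresheaf.S_res U V h _ hf
  induction hf with
  | smul_const g z hg =>
    obtain ⟨U, g', hy, hg'⟩ := hg.exists_contMDiffMap
    let g'' := ContMDiffMap.restrictRingHom (𝓡 m) 𝓘(ℝ, ℝ) ℝ (inf_le_left : U ⊓ A.dom a ≤ U) g'
    have h : (fun x : (U ⊓ A.dom a : Opens M) => A.symVec a x (g x • z)) =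
        (fun x => algebraMap ℝ _ (g'' x)) *
          fun x : (U ⊓ A.dom a : Opens M) => A.symVec a x z := by
      funext x
      rw [map_smul, Pi.mul_apply, ← Algebra.smul_def]
      congr 1
      exact (hg' ⟨x, x.2.1⟩).symm
    refine ⟨U ⊓ A.dom a, ⟨hy, ha⟩, ?_⟩
    rw [h]
    exact Subalgebra.mul_mem _ (Algebra.subset_adjoin (Or.inl ⟨g'', rfl⟩))
      (hres inf_le_right (f := fun _ => z) (A.symVec_mem_polynomialSections a z))
  | add f f' _ _ h h' =>
    obtain ⟨U, hy, h⟩ := h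
    obtain ⟨U', hy', h'⟩ := h'
    refine ⟨U ⊓ U', ⟨hy, hy'⟩, ?_⟩
    simpa only [map_add] using!
      Subalgebra.add_mem _ (hres inf_le_left h) (hres inf_le_right h')
  | congr f f' _ h' h =>
    obtain ⟨U, hy, h⟩ := h
    obtain ⟨U', hU', hUo, hy'⟩ := eventually_nhds_iff.1 h'
    refine ⟨U ⊓ ⟨U', hUo⟩, ⟨hy, hy'⟩, ?_⟩
    have h1 := hres (inf_le_left : U ⊓ ⟨U', hUo⟩ ≤ U) h
    have h2 : (fun x : (U ⊓ ⟨U', hUo⟩ : Opens M) => A.symVec a x (f x)) =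
        fun x : (U ⊓ ⟨U', hUo⟩ : Opens M) => A.symVec a x (f' x) :=
      funext fun x => by rw [hU' x x.2.2]
    exact h2 ▸ h1

end TrivializationAtlas

end Bundle

/-! ### Averaging over the trivializations -/

section Splitting

variable {m n : ℕ} {M : Type u} [TopologicalSpace M] [ChartedSpace (EuclideanSpace ℝ (Fin m)) M]
  {C : GradedAlgSheaf M} {r : Fin n → ℕ}

namespace TrivializationAtlas

variable (A : TrivializationAtlas m C r)

/-- The average over the trivializations `b` of the inclusions of the generators that each `b`
provides: a generator of degree `i + 1` is moved to `b` by the linear part of the transition, is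
regarded there as an element of `Sym V`, and is moved back to `a` by the full transition. -/
def averageGen (a y : M) (i : Fin n) : GSym.Coord r i →ₗ[ℝ] GSym (GSym.Coord r) :=
  ∑ b ∈ A.partition.finsupport y, A.partition b y •
    ((A.trans b a y).toLinearMap ∘ₗ GSym.gen (GSym.Coord r) i ∘ₗ A.linTrans a b i y)

theorem averageGen_apply (a y : M) (i : Fin n) (v : GSym.Coord r i) :
    A.averageGen a y i v = ∑ b ∈ A.partition.finsupport y, A.partition b y •
      A.trans b a y (GSym.gen (GSym.Coord r) i (A.linTrans a b i y v)) := by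
  simp [averageGen, LinearMap.sum_apply]

theorem averageGen_mem (a y : M) (i : Fin n) (v : GSym.Coord r i) :
    A.averageGen a y i v ∈ GSym.homog (GSym.Coord r) ((i : ℕ) + 1) := by
  rw [averageGen_apply]
  exact Submodule.sum_mem _ fun b _ => Submodule.smul_mem _ _
    (A.isGraded_trans b a y _ _ (GSym.gen_mem _ i _))

theorem mem_dom_of_mem_finsupport {b y : M} (hb : b ∈ A.partition.finsupport y) : y ∈ A.dom b :=
  A.subordinate b (subset_tsupport _ ((A.partition.mem_finsupport y).1 hb))

theorem lin_averageGen {a y : M} (ha : y ∈ A.dom a) (i : Fin n) (v : GSym.Coord r i) :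
    GSym.lin r i (A.averageGen a y i v) = v := by
  have h : ∀ b ∈ A.partition.finsupport y, A.partition b y • GSym.lin r i
      (A.trans b a y (GSym.gen (GSym.Coord r) i (A.linTrans a b i y v))) =
        A.partition b y • v := by
    intro b hb
    have hyb := A.mem_dom_of_mem_finsupport hb
    rw [(A.isGraded_trans b a y).lin_apply, GSym.lin_gen_same]
    congr 1
    exact (A.linTrans_linTrans ha hyb ha i v).trans (A.linTrans_self ha i v)
  simp only [averageGen_apply, map_sum, map_smul]
  rw [Finset.sum_congr rfl h, ← Finset.sum_smul,
    A.partition.sum_finsupport y (Set.mem_univ y), one_smul]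

theorem smoothGerm_averageGen {a y : M} (ha : y ∈ A.dom a) (i : Fin n) (v : GSym.Coord r i) :
    SmoothGerm m y fun x => A.averageGen a x i v := by
  have h : SmoothGerm m y fun x => ∑ b ∈ A.partition.fintsupport y, A.partition b x •
      A.trans b a x (GSym.gen (GSym.Coord r) i (A.linTrans a b i x v)) := by
    refine SmoothGerm.sum _ fun b hb => ?_
    have hyb : y ∈ A.dom b := A.subordinate b ((A.partition.mem_fintsupport_iff y b).1 hb)
    refine SmoothGerm.smul (Eventually.of_forall fun x => (A.partition b).contMDiff x) ?_
    refine SmoothGerm.apply_linear (L := fun x => (A.trans b a x).toLinearMap)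
      (A.smoothGerm_trans hyb ha) ?_
    exact SmoothGerm.apply_linear (L := fun _ => GSym.gen (GSym.Coord r) i)
      (fun _ => SmoothGerm.const _) (A.smoothGerm_linTrans ha hyb i v)
  refine SmoothGerm.congr _ _ h ?_
  filter_upwards [A.partition.eventually_finsupport_subset y] with x hx
  rw [averageGen_apply]
  refine Finset.sum_subset hx fun b _ hb => ?_
  have h0 : A.partition b x = 0 := by
    by_contra h0
    exact hb ((A.partition.mem_finsupport x).2 h0)
  rw [h0, zero_smul]

/-- The endomorphism of `Sym V` that extends the averaged inclusion of the generators. -/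
def average (a y : M) : GSym (GSym.Coord r) →ₐ[ℝ] GSym (GSym.Coord r) :=
  GSym.lift (A.averageGen a y) fun i j v w =>
    GSym.homog_comm _ (A.averageGen_mem a y i v) (A.averageGen_mem a y j w)

theorem average_gen (a y : M) (i : Fin n) (v : GSym.Coord r i) :
    A.average a y (GSym.gen _ i v) = A.averageGen a y i v := GSym.lift_gen _ _ i v

theorem isGraded_average (a y : M) : GSym.IsGraded (A.average a y) :=
  GSym.IsGraded.of_gen fun i v => by rw [average_gen]; exact A.averageGen_mem a y i v

theorem isUnipotent_average {a y : M} (ha : y ∈ A.dom a) : GSym.IsUnipotent (A.average a y) :=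
  GSym.IsUnipotent.of_linPart (A.isGraded_average a y) fun i v => by
    rw [GSym.linPart_apply, average_gen, A.lin_averageGen ha]

theorem trans_average {a c y : M} (ha : y ∈ A.dom a) (hc : y ∈ A.dom c)
    (z : GSym (GSym.Coord r)) :
    A.trans a c y (A.average a y z) =
      A.average c y (GSym.map (fun i => A.linTrans a c i y) z) := by
  suffices h : (A.trans a c y).comp (A.average a y) =
      (A.average c y).comp (GSym.map fun i => A.linTrans a c i y) from DFunLike.congr_fun h z
  refine GSym.algHom_ext fun i v => ?_
  rw [AlgHom.comp_apply, AlgHom.comp_apply, GSym.map_gen, average_gen, average_gen,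
    averageGen_apply, averageGen_apply, map_sum]
  refine Finset.sum_congr rfl fun b hb => ?_
  have hyb := A.mem_dom_of_mem_finsupport hb
  rw [map_smul, A.trans_trans hyb ha hc, A.linTrans_linTrans ha hc hyb]

theorem smoothGerm_average {a y : M} (ha : y ∈ A.dom a) {f : M → GSym (GSym.Coord r)}
    (hf : SmoothGerm m y f) : SmoothGerm m y fun x => A.average a x (f x) := by
  refine SmoothGerm.apply_linear (L := fun x => (A.average a x).toLinearMap) (fun z => ?_) hf
  refine SmoothGerm.of_gen (fun i v => ?_) z
  simp only [average_gen]
  exact A.smoothGerm_averageGen ha i v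

/-- The averaged endomorphisms are invertible on smooth germs: on constants, their inverse is a
finite geometric series. -/
theorem exists_average_eq {a y : M} (ha : y ∈ A.dom a) {f : M → GSym (GSym.Coord r)}
    (hf : SmoothGerm m y f) :
    ∃ h, SmoothGerm m y h ∧ ∀ᶠ x in 𝓝 y, A.average a x (h x) = f x := by
  induction hf with
  | smul_const g z hg =>
    obtain ⟨k, hk⟩ := GSym.exists_defect_pow_eq_zero z
    have hpow : ∀ j, SmoothGerm m y fun x => (GSym.defect (A.average a x) ^ j) z := by
      intro j
      induction j with
      | zero => simpa using SmoothGerm.const z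
      | succ j ih =>
        simp only [pow_succ', Module.End.mul_apply, GSym.defect_apply]
        exact ih.sub (A.smoothGerm_average ha ih)
    refine ⟨_, SmoothGerm.smul hg (SmoothGerm.sum (Finset.range k) fun j _ => hpow j), ?_⟩
    filter_upwards [(A.dom a).isOpen.mem_nhds ha] with x hx
    rw [map_smul, GSym.apply_sum_defect_pow (hk _ (A.isUnipotent_average hx))]
  | add f f' _ _ h h' =>
    obtain ⟨h₁, hs₁, he₁⟩ := h
    obtain ⟨h₂, hs₂, he₂⟩ := h'
    refine ⟨_, SmoothGerm.add _ _ hs₁ hs₂, ?_⟩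
    filter_upwards [he₁, he₂] with x hx₁ hx₂
    rw [map_add, hx₁, hx₂]
  | congr f f' _ h' h =>
    obtain ⟨h₁, hs₁, he₁⟩ := h
    refine ⟨h₁, hs₁, ?_⟩
    filter_upwards [he₁, h'] with x hx₁ hx₂
    rw [hx₁, hx₂]

/-! ### The splitting -/

/-- The splitting at `y`, from `Sym W_y` to the trivialization with index `a`. -/
def split (a y : M) : (GSym fun i => A.bundle.fiber i y) →ₐ[ℝ] GSym (GSym.Coord r) :=
  (A.average a y).comp (A.symCoord a y)

theorem split_apply (a y : M) (z : GSym fun i => A.bundle.fiber i y) :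
    A.split a y z = A.average a y (A.symCoord a y z) := rfl

theorem trans_split {a c y : M} (ha : y ∈ A.dom a) (hc : y ∈ A.dom c)
    (z : GSym fun i => A.bundle.fiber i y) : A.trans a c y (A.split a y z) = A.split c y z := by
  rw [split_apply, split_apply, A.trans_average ha hc]
  congr 1
  suffices h : (GSym.map fun i => A.linTrans a c i y).comp (A.symCoord a y) = A.symCoord c y from
    DFunLike.congr_fun h z
  refine GSym.algHom_ext fun i w => ?_
  rw [AlgHom.comp_apply, symCoord, symCoord, GSym.map_gen, GSym.map_gen, GSym.map_gen,
    A.linTrans_fiberCoord ha hc]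

theorem split_bijective {a y : M} (ha : y ∈ A.dom a) : Function.Bijective (A.split a y) :=
  (A.isUnipotent_average ha).bijective.comp
    (Function.bijective_iff_has_inverse.2
      ⟨A.symVec a y, A.symVec_symCoord ha, A.symCoord_symVec ha⟩)

theorem split_mem_homog_iff {a y : M} (ha : y ∈ A.dom a) (l : ℕ)
    (z : GSym fun i => A.bundle.fiber i y) :
    A.split a y z ∈ GSym.homog (GSym.Coord r) l ↔ z ∈ GSym.homog _ l := by
  have hmem : ∀ l, ∀ z ∈ GSym.homog (fun i => A.bundle.fiber i y) l,
      A.split a y z ∈ GSym.homog (GSym.Coord r) l := fun l z hz =>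
    A.isGraded_average a y l _ (GSym.map_mem_homog _ hz)
  exact ⟨GSym.mem_homog_of_map_mem (A.split_bijective ha).injective hmem, hmem l z⟩

/-- The value at `y` of a section of `C`, moved to `Sym W_y` by the splitting. -/
def unsplit {V : Opens M} (y : V) : C.sec V →ₐ[ℝ] GSym fun i => A.bundle.fiber i y :=
  ((AlgEquiv.ofBijective (A.split y y) (A.split_bijective (A.mem_dom y))).symm :
    GSym (GSym.Coord r) →ₐ[ℝ] GSym fun i => A.bundle.fiber i y).comp
      ((A.triv y).evAt y y.2 (A.mem_dom y))

theorem split_unsplit {V : Opens M} (y : V) {a : M} (ha : (y : M) ∈ A.dom a) (c : C.sec V) :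
    A.split a y (A.unsplit y c) = (A.triv a).evAt y y.2 ha c := by
  have h : A.split y y (A.unsplit y c) = (A.triv y).evAt y y.2 (A.mem_dom y) c :=
    (AlgEquiv.ofBijective (A.split y y) (A.split_bijective (A.mem_dom y))).apply_symm_apply _
  rw [← A.trans_split (A.mem_dom y) ha, h]
  exact GradedAlgSheaf.IsoOn.transition_evAt _ _ c y.2 (A.mem_dom y) ha

theorem unsplit_eq_iff {V : Opens M} (y : V) {a : M} (ha : (y : M) ∈ A.dom a) (c : C.sec V)
    (z : GSym fun i => A.bundle.fiber i y) :
    A.unsplit y c = z ↔ (A.triv a).evAt y y.2 ha c = A.split a y z := by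
  rw [← A.split_unsplit y ha]
  exact (A.split_bijective ha).injective.eq_iff.symm

theorem unsplit_res {V V' : Opens M} (h : V' ≤ V) (y : V') (c : C.sec V) :
    A.unsplit y (C.res h c) = A.unsplit ⟨y, h y.2⟩ c :=
  (A.unsplit_eq_iff y (A.mem_dom y) _ _).2 (by
    rw [GradedAlgSheaf.IsoOn.evAt_res, A.split_unsplit ⟨y, h y.2⟩ (A.mem_dom y)])

theorem unsplit_mem_sections {V : Opens M} (c : C.sec V) :
    (fun y : V => A.unsplit y c) ∈ A.bundle.symPresheaf.sections V := by
  refine (SectionPresheaf.mem_sections _).2 fun x => ?_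
  have hx := A.mem_dom x
  obtain ⟨h, hs, he⟩ := A.exists_average_eq hx ((A.triv x).smoothGerm_ev c x.2 hx)
  obtain ⟨U, hxU, hU⟩ := A.exists_symVec_mem_polynomialSections hx hs
  obtain ⟨W, hW, hWo, hxW⟩ := eventually_nhds_iff.1 he
  let U' : Opens M := (U ⊓ ⟨W, hWo⟩) ⊓ (V ⊓ A.dom x)
  have hU'U : U' ≤ U := inf_le_left.trans inf_le_left
  have hU'V : U' ≤ V := inf_le_right.trans inf_le_left
  refine ⟨U', ⟨⟨hxU, hxW⟩, x.2, hx⟩, hU'V, ?_⟩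
  have h1 := A.bundle.symPresheaf.S_res U U' hU'U _ hU
  have h2 : (fun y : U' => A.symVec x y (h y)) = fun y : U' => A.unsplit ⟨y, hU'V y.2⟩ c := by
    funext y
    have hy : (y : M) ∈ A.dom x := y.2.2.2
    refine ((A.unsplit_eq_iff ⟨y, hU'V y.2⟩ hy c _).2 ?_).symm
    rw [split_apply, A.symCoord_symVec hy, hW y y.2.1.2, GradedAlgSheaf.IsoOn.ev_eq]
  exact h2 ▸ h1

theorem sec_ext_unsplit {V : Opens M} {c c' : C.sec V}
    (h : ∀ y : V, A.unsplit y c = A.unsplit y c') : c = c' := by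
  refine C.eq_of_locally_eq fun x hx => ⟨V ⊓ A.dom x, inf_le_left, ⟨hx, A.mem_dom x⟩, ?_⟩
  refine (A.triv x).sec_ext inf_le_right fun y hy => ?_
  rw [GradedAlgSheaf.IsoOn.evAt_res, GradedAlgSheaf.IsoOn.evAt_res,
    ← A.split_unsplit ⟨y, hy.1⟩ hy.2, ← A.split_unsplit ⟨y, hy.1⟩ hy.2, h]

theorem exists_unsplit_eq {V : Opens M} {s : ∀ y : V, GSym fun i => A.bundle.fiber i y}
    (hs : s ∈ A.bundle.symPresheaf.sections V) : ∃ c : C.sec V, ∀ y : V, A.unsplit y c = s y := by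
  classical
  have hloc : ∀ x : V, ∃ (U : Opens M) (hU : U ≤ V) (c : C.sec U), (x : M) ∈ U ∧
      ∀ y : U, A.unsplit y c = s ⟨y, hU y.2⟩ := by
    intro x
    obtain ⟨U, hxU, hUV, hU⟩ := (SectionPresheaf.mem_sections _).1 hs x
    let f : M → GSym (GSym.Coord r) := fun y =>
      if hy : y ∈ U then A.symCoord x y (s ⟨y, hUV hy⟩) else 0
    have hf : ∀ y : U, f y = A.symCoord x y (s ⟨y, hUV y.2⟩) := fun y => by simp [f, y.2]
    obtain ⟨c, hc⟩ := (A.triv x).exists_sec (inf_le_right : U ⊓ A.dom x ≤ A.dom x)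
      (f := fun y => A.average x y (f y)) fun y hy =>
        A.smoothGerm_average hy.2 (A.smoothGerm_symCoord hy.2 hy.1 hU hf)
    refine ⟨U ⊓ A.dom x, inf_le_left.trans hUV, c, ⟨hxU, A.mem_dom x⟩, fun y => ?_⟩
    rw [A.unsplit_eq_iff y y.2.2, hc y y.2, hf ⟨y, y.2.1⟩]
    rfl
  choose U hU c hxU hc using hloc
  obtain ⟨t, ht⟩ := C.exists_gluing U V hU
    (fun x hx => Opens.mem_iSup.2 ⟨⟨x, hx⟩, hxU ⟨x, hx⟩⟩) c fun x x' =>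
      A.sec_ext_unsplit fun y => by rw [A.unsplit_res, A.unsplit_res, hc, hc]
  refine ⟨t, fun y => ?_⟩
  have h := hc y ⟨y, hxU y⟩
  rwa [← ht, A.unsplit_res] at h

/-- The isomorphism between `C` and the sections of `Sym W`, as a homomorphism on sections. -/
def unsplitHom (V : Opens M) : C.sec V →ₐ[ℝ] A.bundle.symSheaf.sec V where
  toFun c := ⟨fun y => A.unsplit y c, A.unsplit_mem_sections c⟩
  map_one' := Subtype.ext (funext fun y => map_one (A.unsplit y))
  map_mul' c d := Subtype.ext (funext fun y => map_mul (A.unsplit y) c d)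
  map_zero' := Subtype.ext (funext fun y => map_zero (A.unsplit y))
  map_add' c d := Subtype.ext (funext fun y => map_add (A.unsplit y) c d)
  commutes' t := Subtype.ext (funext fun y => (A.unsplit y).commutes t)

theorem unsplitHom_bijective (V : Opens M) : Function.Bijective (A.unsplitHom V) := by
  refine ⟨fun c c' h => A.sec_ext_unsplit fun y => congrFun (congrArg Subtype.val h) y, ?_⟩
  rintro ⟨s, hs⟩
  obtain ⟨c, hc⟩ := A.exists_unsplit_eq hs
  exact ⟨c, Subtype.ext (funext hc)⟩

theorem mem_deg_iff_unsplit {V : Opens M} (l : ℕ) (c : C.sec V) :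
    c ∈ C.deg V l ↔ ∀ y : V, A.unsplit y c ∈ GSym.homog (fun i => A.bundle.fiber i y) l := by
  refine ⟨fun hc y => ?_, fun h => C.local_mem V l c fun x hx =>
    ⟨V ⊓ A.dom x, inf_le_left, ⟨hx, A.mem_dom x⟩, ?_⟩⟩
  · rw [← A.split_mem_homog_iff (A.mem_dom y), A.split_unsplit y (A.mem_dom y)]
    exact (A.triv y).evAt_mem_homog hc y.2 (A.mem_dom y)
  · refine ((A.triv x).mem_deg_iff_evAt inf_le_right l (C.res inf_le_left c)).2 fun y hy => ?_
    rw [GradedAlgSheaf.IsoOn.evAt_res, ← A.split_unsplit ⟨y, hy.1⟩ hy.2]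
    exact (A.split_mem_homog_iff hy.2 l _).2 (h ⟨y, hy.1⟩)

/-- The sheaf `C` is isomorphic to the sheaf of sections of `Sym W`. -/
def unsplitIso : C.IsoOn A.bundle.symSheaf ⊤ where
  equiv V _ := AlgEquiv.ofBijective (A.unsplitHom V) (A.unsplitHom_bijective V)
  naturality _ _ _ h c := Subtype.ext (funext fun y => A.unsplit_res h y c)
  mem_deg_iff _ _ l c := A.bundle.symPresheaf.mem_degree.trans (A.mem_deg_iff_unsplit l c).symm

theorem isNManifold_symSheaf : IsNManifold m n A.bundle.symSheaf :=
  ⟨r, fun x => ⟨A.dom x, A.mem_dom x, ⟨(A.unsplitIso.symm.mono le_top).trans (A.triv x)⟩⟩⟩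

/-- The splitting as an isomorphism of `ℕ`-manifolds over the identity of `M`. -/
def splitting : NManifoldIso (m := m) (m' := m) C A.bundle.symSheaf where
  body := Diffeomorph.refl (𝓡 m) M ∞
  sharp V := A.unsplitIso.symm.equiv V le_top
  naturality V V' h s := A.unsplitIso.symm.naturality V V' le_top h s
  mem_deg_iff V l s := A.unsplitIso.symm.mem_deg_iff V le_top l s

end TrivializationAtlas

theorem IsNManifold.exists_trivializationAtlas [IsManifold (𝓡 m) ∞ M] [T2Space M]
    [SecondCountableTopology M] (hC : IsNManifold m n C) :
    ∃ r : Fin n → ℕ, Nonempty (TrivializationAtlas m C r) := by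
  obtain ⟨r, h⟩ := hC
  choose U hU φ using h
  have : LocallyCompactSpace M := ChartedSpace.locallyCompactSpace (EuclideanSpace ℝ (Fin m)) M
  obtain ⟨ρ, hρ⟩ := SmoothPartitionOfUnity.exists_isSubordinate (𝓡 m) isClosed_univ
    (fun a => (U a : Set M)) (fun a => (U a).isOpen) fun x _ => Set.mem_iUnion.2 ⟨x, hU x⟩
  exact ⟨r, ⟨⟨U, hU, fun a => (φ a).some, ρ, hρ⟩⟩⟩

end Splitting

end

theorem mainTheorem4 (n m : ℕ) (M : Type u) [TopologicalSpace M]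
    [ChartedSpace (EuclideanSpace ℝ (Fin m)) M] [IsManifold (𝓡 m) ∞ M]
    [T2Space M] [SecondCountableTopology M]
    (C : GradedAlgSheaf M) (hC : IsNManifold m n C) :
    ∃ W : GradedVectorBundle m n M, IsNManifold m n W.symSheaf ∧
      ∃ Φ : NManifoldIso (m := m) (m' := m) C W.symSheaf,
        Φ.body = Diffeomorph.refl (𝓡 m) M ∞ := by
  obtain ⟨r, ⟨A⟩⟩ := hC.exists_trivializationAtlas
  exact ⟨A.bundle, A.isNManifold_symSheaf, A.splitting, rfl⟩
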